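/- Let $\mathfrak M,\mathfrak N$ be complex Hilbert spaces, $\mathbb D=\{|\lambda|<1\}$. For a contraction $T:H_1\to H_2$ put $D_T=(I-T^*T)^{1/2}$, $\mathfrak D_T=\overline{\operatorname{ran}}\,D_T$, and let $$\mathbf J_T=\begin{bmatrix}T&D_{T^*}\\ D_T&-T^*\end{bmatrix}:H_1\oplus\mathfrak D_{T^*}\to H_2\oplus\mathfrak D_T .$$ The Schur class $\mathbf S(\mathfrak M,\mathfrak N)$ consists of the holomorphic functions on $\mathbb D$ whose values are contractions from $\mathfrak M$ to $\mathfrak N$. $\Theta\in\mathbf S(\mathfrak M,\mathfrak N)$ is purely contractive if $\ker D_{\Theta(0)}=\{0\}$. Two functions $\Theta\in \mathbf S(\mathfrak M,\mathfrak N)$ and $\Omega\in\mathbf S(\mathfrak K,\mathfrak L)$ coincide if $V\Theta(\lambda)U=\Omega(\lambda)$, $\lambda\in\mathbb D$, for some unitary operators $V:\mathfrak N\to\mathfrak L$, $U:\mathfrak K\to\mathfrak M$. The characteristic function of a contraction $T$ on $H$ is $$\Phi_T(\lambda)=\bigl(-T+\lambda D_{T^*}(I-\lambda T^*)^{-1}D_T\bigr)\restriction\mathfrak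 D_T:\mathfrak D_T\to\mathfrak D_{T^*},\qquad\lambda\in\mathbb D .$$ Schur parameters. A choice sequence is a sequence of contractions $\Gamma_0:\mathfrak M\to\mathfrak N$, $\Gamma_n:\mathfrak D_{\Gamma_{n-1}}\to\mathfrak D_{\Gamma_{n-1}^*}$, $n\ge1$. (If some $\Gamma_m$ is unitary, all later operators act between zero spaces.) It is the sequence of Schur parameters of $\Theta$ if there are functions $\Theta_0=\Theta$ and $\Theta_n\in\mathbf S(\mathfrak D_{\Gamma_{n-1}},\mathfrak D_{\Gamma^*_{n-1}})$, $n\ge1$, such that for all $n\ge0$ and $\lambda\in\mathbb D$ $$\Gamma_n=\Theta_n(0),\qquad \Theta_n(\lambda)=\Gamma_n+D_{\Gamma_n^*}\,\lambda\Theta_{n+1}(\lambda)\bigl(I+\lambda\Gamma_n^*\Theta_{n+1}(\lambda)\bigr)^{-1}D_{\Gamma_n}.$$ Truncated block operator CMV matrices. For a choice sequence $\{\Gamma_n\}$ let $$\mathfrak H_0=\bigoplus_{n\ge0}\bigl(\mathfrak D_{\Gamma_{2n}}\oplus\mathfrak D_{\Gamma^*_{2n+1}}\bigr),\qquad \widetilde{\mathfrak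 H}_0=\bigoplus_{n\ge0}\bigl(\mathfrak D_{\Gamma^*_{2n}}\oplus\mathfrak D_{\Gamma_{2n+1}}\bigr),$$ $$\mathcal V_0=\bigoplus_{n\ge0}\mathbf J_{\Gamma_{2n+1}}:\mathfrak H_0\to\widetilde{\mathfrak H}_0,\qquad \mathcal L_0=\bigoplus_{n\ge0}\mathbf J_{\Gamma_{2n}}:\mathfrak M\oplus\widetilde{\mathfrak H}_0\to\mathfrak N\oplus\mathfrak H_0 ,$$ $$\mathcal U_0=\mathcal L_0\,(I_{\mathfrak M}\oplus\mathcal V_0):\mathfrak M\oplus\mathfrak H_0\to\mathfrak N\oplus\mathfrak H_0,\qquad \widetilde{\mathcal U}_0=(I_{\mathfrak N}\oplus\mathcal V_0)\,\mathcal L_0:\mathfrak M\oplus\widetilde{\mathfrak H}_0\to\mathfrak N\oplus\widetilde{\mathfrak H}_0 ,$$ $$\mathcal T_0(\{\Gamma_n\})=P_{\mathfrak H_0}\,\mathcal U_0\restriction\mathfrak H_0,\qquad \widetilde{\mathcal T}_0(\{\Gamma_n\})=P_{\widetilde{\mathfrak H}_0}\,\widetilde{\mathcal U}_0\restriction\widetilde{\mathfrak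 H}_0 .$$ **Theorem.** Let $\Theta\in\mathbf S(\mathfrak M,\mathfrak N)$ be purely contractive. Then $\Theta$ has a sequence of Schur parameters, and if $\{\Gamma_n\}_{n\ge0}$ are the Schur parameters of $\Theta$, then the operators $\mathcal T_0(\{\Gamma_n^*\}_{n\ge0})$ and $\widetilde{\mathcal T}_0(\{\Gamma_n^*\}_{n\ge0})$, built from the choice sequence $\Gamma_0^*:\mathfrak N\to\mathfrak M$, $\Gamma_n^*:\mathfrak D_{\Gamma^*_{n-1}}\to\mathfrak D_{\Gamma_{n-1}}$, are completely non-unitary contractions whose characteristic functions coincide with $\Theta$. In particular, every purely contractive function of the Schur class coincides with the characteristic function of some completely non-unitary contraction. -/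

import Mathlib

open scoped InnerProductSpace

noncomputable section

namespace BlockCMV

/-! ### Contractions, defect operators and defect spaces -/

section Contractions

variable {H₁ H₂ : Type*}
  [NormedAddCommGroup H₁] [InnerProductSpace ℂ H₁] [CompleteSpace H₁]
  [NormedAddCommGroup H₂] [InnerProductSpace ℂ H₂] [CompleteSpace H₂]

/-- The defect operator `D_T = (I - T* T)^{1/2}` of a contraction `T` (the square root is the
nonnegative one of the continuous functional calculus). -/
def defectOp (T : H₁ →L[ℂ] H₂) : H₁ →L[ℂ] H₁ :=
  CFC.sqrt (1 - (ContinuousLinearMap.adjoint T).comp T)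

/-- The defect space of `T`: the closure of the range of `D_T`. -/
def defectSpace (T : H₁ →L[ℂ] H₂) : Submodule ℂ H₁ :=
  (defectOp T).range.topologicalClosure

instance (T : H₁ →L[ℂ] H₂) : CompleteSpace (defectSpace T) :=
  (Submodule.isClosed_topologicalClosure _).completeSpace_coe

theorem defectOp_mem (T : H₁ →L[ℂ] H₂) (x : H₁) : defectOp T x ∈ defectSpace T :=
  Submodule.le_topologicalClosure _ ⟨x, rfl⟩

theorem one_sub_nonneg {T : H₁ →L[ℂ] H₂} (hT : ‖T‖ ≤ 1) :
    0 ≤ 1 - (ContinuousLinearMap.adjoint T).comp T := by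
  rw [ContinuousLinearMap.nonneg_iff_isPositive, ContinuousLinearMap.isPositive_iff]
  constructor
  · intro x y
    simp [inner_sub_left, inner_sub_right, ContinuousLinearMap.adjoint_inner_left,
      ContinuousLinearMap.adjoint_inner_right]
  · intro x
    have h : ‖T x‖ ≤ ‖x‖ := by
      simpa using T.le_of_opNorm_le hT x
    have : ⟪((1 : H₁ →L[ℂ] H₁) - (ContinuousLinearMap.adjoint T).comp T) x, x⟫_ℂ
        = ((‖x‖ ^ 2 - ‖T x‖ ^ 2 : ℝ) : ℂ) := by
      simp [ContinuousLinearMap.adjoint_inner_left, inner_self_eq_norm_sq_to_K]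
    rw [this]
    have : 0 ≤ ‖x‖ ^ 2 - ‖T x‖ ^ 2 := by
      have := pow_le_pow_left₀ (norm_nonneg _) h 2
      linarith
    exact_mod_cast this

theorem defectOp_isSelfAdjoint (T : H₁ →L[ℂ] H₂) (x y : H₁) :
    ⟪defectOp T x, y⟫_ℂ = ⟪x, defectOp T y⟫_ℂ := by
  have h : IsSelfAdjoint (defectOp T) := IsSelfAdjoint.of_nonneg (CFC.sqrt_nonneg _)
  exact (ContinuousLinearMap.isSelfAdjoint_iff_isSymmetric.1 h) x y

theorem defectOp_defectOp {T : H₁ →L[ℂ] H₂} (hT : ‖T‖ ≤ 1) (x : H₁) :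
    defectOp T (defectOp T x) = x - ContinuousLinearMap.adjoint T (T x) := by
  have h := CFC.sqrt_mul_sqrt_self _ (one_sub_nonneg hT)
  have h2 := congrArg (fun A : H₁ →L[ℂ] H₁ => A x) h
  simpa [defectOp] using h2

theorem norm_defectOp_sq {T : H₁ →L[ℂ] H₂} (hT : ‖T‖ ≤ 1) (x : H₁) :
    ‖defectOp T x‖ ^ 2 = ‖x‖ ^ 2 - ‖T x‖ ^ 2 := by
  have h : ⟪defectOp T x, defectOp T x⟫_ℂ = ((‖x‖ ^ 2 - ‖T x‖ ^ 2 : ℝ) : ℂ) := by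
    rw [defectOp_isSelfAdjoint, defectOp_defectOp hT]
    simp [ContinuousLinearMap.adjoint_inner_right, inner_self_eq_norm_sq_to_K]
  rw [inner_self_eq_norm_sq_to_K] at h
  exact Complex.ofReal_injective (by simpa using h)

theorem norm_defectOp_apply_le {T : H₁ →L[ℂ] H₂} (hT : ‖T‖ ≤ 1) (x : H₁) :
    ‖defectOp T x‖ ≤ ‖x‖ := by
  have h := norm_defectOp_sq hT x
  nlinarith [sq_nonneg ‖T x‖, norm_nonneg x, norm_nonneg (defectOp T x)]

theorem norm_adjoint_le {T : H₁ →L[ℂ] H₂} (hT : ‖T‖ ≤ 1) :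
    ‖ContinuousLinearMap.adjoint T‖ ≤ 1 := by
  simpa using hT

theorem mem_defectSpace_iff (T : H₁ →L[ℂ] H₂) (x : H₁) :
    x ∈ defectSpace T ↔ ∀ y, defectOp T y = 0 → ⟪y, x⟫_ℂ = 0 := by
  rw [defectSpace, ← Submodule.orthogonal_orthogonal_eq_closure, Submodule.mem_orthogonal]
  have : ∀ y, y ∈ (defectOp T).rangeᗮ ↔ defectOp T y = 0 := by
    intro y
    rw [Submodule.mem_orthogonal]
    constructor
    · intro h
      have := h (defectOp T (defectOp T y)) ⟨_, rfl⟩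
      rw [defectOp_isSelfAdjoint] at this
      exact inner_self_eq_zero.1 this
    · rintro h _ ⟨z, rfl⟩
      change ⟪defectOp T z, y⟫_ℂ = 0
      rw [defectOp_isSelfAdjoint, h, inner_zero_right]
  simp only [this]

/-- A contraction `T` maps its defect space into the defect space of its adjoint. -/
theorem apply_mem_defectSpace {T : H₁ →L[ℂ] H₂} (hT : ‖T‖ ≤ 1) {x : H₁}
    (hx : x ∈ defectSpace T) : T x ∈ defectSpace (ContinuousLinearMap.adjoint T) := by
  rw [mem_defectSpace_iff] at hx ⊢
  intro y hy
  rw [← ContinuousLinearMap.adjoint_inner_left]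
  apply hx
  have h0 : y = T (ContinuousLinearMap.adjoint T y) := by
    have := defectOp_defectOp (norm_adjoint_le hT) y
    rw [hy, map_zero, ContinuousLinearMap.adjoint_adjoint] at this
    exact (sub_eq_zero.1 this.symm)
  have h1 := norm_defectOp_sq (norm_adjoint_le hT) y
  have h2 := norm_defectOp_sq hT (ContinuousLinearMap.adjoint T y)
  rw [← h0] at h2
  rw [hy, norm_zero] at h1
  have : ‖defectOp T (ContinuousLinearMap.adjoint T y)‖ ^ 2 = 0 := by
    rw [h2]; linarith
  simpa using this

/-- The Schur class `S(H₁, H₂)`: functions holomorphic in the open unit disk whose values are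
contractions from `H₁` to `H₂`. -/
structure IsSchurClass (Θ : ℂ → H₁ →L[ℂ] H₂) : Prop where
  holomorphic : DifferentiableOn ℂ Θ (Metric.ball 0 1)
  contractive : ∀ z ∈ Metric.ball (0 : ℂ) 1, ‖Θ z‖ ≤ 1

/-- `Θ` is purely contractive if `ker D_{Θ(0)} = {0}`. -/
def IsPurelyContractive (Θ : ℂ → H₁ →L[ℂ] H₂) : Prop :=
  (defectOp (Θ 0)).ker = ⊥

/-- Two functions `Θ` (from `H₁` to `H₂`) and `Ω` (from `K₁` to `K₂`) on the unit disk coincide if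
`V Θ(z) U = Ω(z)`, `|z| < 1`, for some unitary operators `V : H₂ → K₂` and `U : K₁ → H₁`. -/
def Coincide {K₁ K₂ : Type*}
    [NormedAddCommGroup K₁] [InnerProductSpace ℂ K₁]
    [NormedAddCommGroup K₂] [InnerProductSpace ℂ K₂]
    (Θ : ℂ → H₁ →L[ℂ] H₂) (Ω : ℂ → K₁ →L[ℂ] K₂) : Prop :=
  ∃ (V : H₂ ≃ₗᵢ[ℂ] K₂) (U : K₁ ≃ₗᵢ[ℂ] H₁),
    ∀ z ∈ Metric.ball (0 : ℂ) 1, ∀ x : K₁, V (Θ z (U x)) = Ω z x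

end Contractions

section SingleOperator

variable {H : Type*} [NormedAddCommGroup H] [InnerProductSpace ℂ H] [CompleteSpace H]

/-- The contraction `T` is completely non-unitary: the only closed subspace that reduces `T` and on
which `T` is unitary is `{0}`. -/
def IsCompletelyNonUnitary (T : H →L[ℂ] H) : Prop :=
  ‖T‖ ≤ 1 ∧ ∀ K : Submodule ℂ H, IsClosed (K : Set H) →
    (∀ x ∈ K, T x ∈ K) → (∀ x ∈ K, ContinuousLinearMap.adjoint T x ∈ K) →
    (∀ x ∈ K, ContinuousLinearMap.adjoint T (T x) = x ∧
      T (ContinuousLinearMap.adjoint T x) = x) →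
    K = ⊥

/-- The operator `-T + z D_{T*} (I - z T*)⁻¹ D_T` on `H`. For a contraction `T` and `|z| < 1` the
operator `I - z T*` is invertible, so that `Ring.inverse` is the inverse. -/
def charOp (T : H →L[ℂ] H) (z : ℂ) : H →L[ℂ] H :=
  -T + z • (defectOp (ContinuousLinearMap.adjoint T) *
    Ring.inverse (1 - z • ContinuousLinearMap.adjoint T) * defectOp T)

theorem charOp_mem (T : H →L[ℂ] H) (hT : ‖T‖ ≤ 1) (z : ℂ) (x : defectSpace T) :
    charOp T z x ∈ defectSpace (ContinuousLinearMap.adjoint T) := by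
  exact add_mem (neg_mem (apply_mem_defectSpace hT x.2))
    (Submodule.smul_mem _ _ (defectOp_mem _ _))

/-- The Sz.-Nagy--Foias characteristic function of the contraction `T`, as an operator from the
defect space of `T` to the defect space of `T*`. -/
def charFun (T : H →L[ℂ] H) (hT : ‖T‖ ≤ 1) (z : ℂ) :
    defectSpace T →L[ℂ] defectSpace (ContinuousLinearMap.adjoint T) :=
  ((charOp T z).comp (defectSpace T).subtypeL).codRestrict _ (charOp_mem T hT z)

end SingleOperator

/-! ### Choice sequences and the Schur algorithm -/

/-- A choice sequence: contractions `Γ₀ : M → N` and `Γₙ : 𝔇_{Γₙ₋₁} → 𝔇_{Γₙ₋₁*}` for `n ≥ 1`.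
The defect spaces are recorded as subspaces of `M` and `N`: `E 0 = M`, `F 0 = N`,
`E (n + 1) = 𝔇_{Γₙ} ⊆ E n` and `F (n + 1) = 𝔇_{Γₙ*} ⊆ F n`. A sequence which terminates with a
unitary `Γₘ` is continued by the zero operators between the zero spaces `𝔇_{Γₘ}`, `𝔇_{Γₘ*}`. -/
structure ChoiceSequence (M N : Type*)
    [NormedAddCommGroup M] [InnerProductSpace ℂ M]
    [NormedAddCommGroup N] [InnerProductSpace ℂ N] where
  E : ℕ → Submodule ℂ M
  F : ℕ → Submodule ℂ N
  [completeE : ∀ n, CompleteSpace (E n)]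
  [completeF : ∀ n, CompleteSpace (F n)]
  Γ : ∀ n, E n →L[ℂ] F n
  contractive : ∀ n, ‖Γ n‖ ≤ 1
  E_zero : E 0 = ⊤
  F_zero : F 0 = ⊤
  E_succ : ∀ n, E (n + 1) = (defectSpace (Γ n)).map (E n).subtype
  F_succ : ∀ n, F (n + 1) =
    (defectSpace (ContinuousLinearMap.adjoint (Γ n))).map (F n).subtype

namespace ChoiceSequence

variable {M N : Type*}
  [NormedAddCommGroup M] [InnerProductSpace ℂ M]
  [NormedAddCommGroup N] [InnerProductSpace ℂ N]

instance (c : ChoiceSequence M N) (n : ℕ) : CompleteSpace (c.E n) := c.completeE n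

instance (c : ChoiceSequence M N) (n : ℕ) : CompleteSpace (c.F n) := c.completeF n

/-- The choice sequence `{Γₙ*}`. -/
def adj (c : ChoiceSequence M N) : ChoiceSequence N M where
  E := c.F
  F := c.E
  Γ n := ContinuousLinearMap.adjoint (c.Γ n)
  contractive n := norm_adjoint_le (c.contractive n)
  E_zero := c.F_zero
  F_zero := c.E_zero
  E_succ := c.F_succ
  F_succ n := by rw [ContinuousLinearMap.adjoint_adjoint]; exact c.E_succ n

theorem mem_E_succ (c : ChoiceSequence M N) (n : ℕ) {x : c.E n} (hx : x ∈ defectSpace (c.Γ n)) :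
    (x : M) ∈ c.E (n + 1) := by
  rw [c.E_succ]; exact ⟨x, hx, rfl⟩

theorem F_le (c : ChoiceSequence M N) (n : ℕ) : c.F (n + 1) ≤ c.F n := by
  rw [c.F_succ]; rintro _ ⟨x, -, rfl⟩; exact x.2

theorem mem_defectSpace_of_mem (c : ChoiceSequence M N) (n : ℕ) (y : c.F n)
    (hy : (y : N) ∈ c.F (n + 1)) :
    y ∈ defectSpace (ContinuousLinearMap.adjoint (c.Γ n)) := by
  rw [c.F_succ] at hy
  obtain ⟨z, hz, hzy⟩ := hy
  have : z = y := Subtype.ext hzy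
  exact this ▸ hz

/-- The inclusion of `𝔇_{Γₙ*}` in the space containing the range of `Γₙ`. -/
def inclF (c : ChoiceSequence M N) (n : ℕ) : c.F (n + 1) →L[ℂ] c.F n :=
  (c.F (n + 1)).subtypeL.codRestrict (c.F n) (fun y => c.F_le n y.2)

/-- `D_{Γₙ}`, as an operator into `𝔇_{Γₙ}`. -/
def D (c : ChoiceSequence M N) (n : ℕ) : c.E n →L[ℂ] c.E (n + 1) :=
  ((c.E n).subtypeL.comp (defectOp (c.Γ n))).codRestrict (c.E (n + 1))
    (fun _ => c.mem_E_succ n (defectOp_mem _ _))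

/-- `D_{Γₙ*}`, restricted to `𝔇_{Γₙ*}`. -/
def Dstar (c : ChoiceSequence M N) (n : ℕ) : c.F (n + 1) →L[ℂ] c.F n :=
  (defectOp (ContinuousLinearMap.adjoint (c.Γ n))).comp (c.inclF n)

/-- `Γₙ*`, restricted to an operator from `𝔇_{Γₙ*}` to `𝔇_{Γₙ}`. -/
def Γstar (c : ChoiceSequence M N) (n : ℕ) : c.F (n + 1) →L[ℂ] c.E (n + 1) :=
  ((c.E n).subtypeL.comp ((ContinuousLinearMap.adjoint (c.Γ n)).comp (c.inclF n))).codRestrict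
    (c.E (n + 1)) (fun y => c.mem_E_succ n (by
      have h := apply_mem_defectSpace (norm_adjoint_le (c.contractive n))
        (c.mem_defectSpace_of_mem n (c.inclF n y) y.2)
      rwa [ContinuousLinearMap.adjoint_adjoint] at h))

/-- `c` is the sequence of Schur parameters of `Θ`: there are Schur class functions
`θ n ∈ S(𝔇_{Γₙ₋₁}, 𝔇_{Γₙ₋₁*})` (the Schur iterates) such that `θ 0 = Θ`, `Γₙ = θ n (0)`, and
`Z(z) = z θ (n + 1) (z)` is the Möbius parameter of `θ n`, i.e.
`θ n (z) = Γₙ + D_{Γₙ*} Z(z) (I + Γₙ* Z(z))⁻¹ D_{Γₙ}` for `|z| < 1`. As `‖Z(z)‖ < 1`, the operator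
`I + Γₙ* Z(z)` on `𝔇_{Γₙ}` is invertible and `Ring.inverse` is its inverse. -/
def IsSchurParametersOf (c : ChoiceSequence M N) (Θ : ℂ → M →L[ℂ] N) : Prop :=
  ∃ θ : ∀ n, ℂ → c.E n →L[ℂ] c.F n,
    (∀ n, IsSchurClass (θ n)) ∧
    (∀ z ∈ Metric.ball (0 : ℂ) 1, ∀ x : c.E 0, (θ 0 z x : N) = Θ z x) ∧
    (∀ n, c.Γ n = θ n 0) ∧
    ∀ n, ∀ z ∈ Metric.ball (0 : ℂ) 1,
      θ n z = c.Γ n + (c.Dstar n).comp ((z • θ (n + 1) z).comp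
        ((Ring.inverse (1 + (c.Γstar n).comp (z • θ (n + 1) z))).comp (c.D n)))

/-! ### Block operator CMV matrices -/

/-- The elementary rotation `J_{Γₙ} = [Γₙ, D_{Γₙ*}; D_{Γₙ}, -Γₙ*]` from
`𝔇_{Γₙ₋₁} ⊕ 𝔇_{Γₙ*}` to `𝔇_{Γₙ₋₁*} ⊕ 𝔇_{Γₙ}`. If `Γₙ` is isometric, co-isometric or unitary, then
some of the summands are `{0}` and this is the row `[Γₙ, I]`, the column `[Γₙ; D_{Γₙ}]` or `Γₙ`. -/
def J (c : ChoiceSequence M N) (n : ℕ) :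
    WithLp 2 (c.E n × c.F (n + 1)) →L[ℂ] WithLp 2 (c.F n × c.E (n + 1)) :=
  ((WithLp.prodContinuousLinearEquiv 2 ℂ (c.F n) (c.E (n + 1))).symm :
      (c.F n × c.E (n + 1)) →L[ℂ] WithLp 2 (c.F n × c.E (n + 1))).comp
    (((c.Γ n).comp (WithLp.fstL 2 ℂ (c.E n) (c.F (n + 1))) +
        (c.Dstar n).comp (WithLp.sndL 2 ℂ (c.E n) (c.F (n + 1)))).prod
      ((c.D n).comp (WithLp.fstL 2 ℂ (c.E n) (c.F (n + 1))) -
        (c.Γstar n).comp (WithLp.sndL 2 ℂ (c.E n) (c.F (n + 1)))))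

theorem norm_J_apply_le (c : ChoiceSequence M N) (n : ℕ)
    (p : WithLp 2 (c.E n × c.F (n + 1))) : ‖c.J n p‖ ≤ 4 * ‖p‖ := by
  have hp := WithLp.prod_norm_sq_eq_of_L2 p
  have hJ := WithLp.prod_norm_sq_eq_of_L2 (c.J n p)
  have h1 : ‖p.fst‖ ≤ ‖p‖ := by nlinarith [norm_nonneg p, norm_nonneg p.fst, sq_nonneg ‖p.snd‖]
  have h2 : ‖p.snd‖ ≤ ‖p‖ := by nlinarith [norm_nonneg p, norm_nonneg p.snd, sq_nonneg ‖p.fst‖]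
  have a1 : ‖c.Γ n p.fst‖ ≤ ‖p.fst‖ := by
    simpa using (c.Γ n).le_of_opNorm_le (c.contractive n) p.fst
  have a2 : ‖c.Dstar n p.snd‖ ≤ ‖p.snd‖ :=
    norm_defectOp_apply_le (norm_adjoint_le (c.contractive n)) (c.inclF n p.snd)
  have a3 : ‖c.D n p.fst‖ ≤ ‖p.fst‖ := norm_defectOp_apply_le (c.contractive n) p.fst
  have a4 : ‖c.Γstar n p.snd‖ ≤ ‖p.snd‖ := by
    have := (ContinuousLinearMap.adjoint (c.Γ n)).le_of_opNorm_le
      (norm_adjoint_le (c.contractive n)) (c.inclF n p.snd)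
    rw [one_mul] at this
    exact this
  have b1 : ‖(c.J n p).fst‖ ≤ 2 * ‖p‖ := by
    have : ‖(c.J n p).fst‖ ≤ ‖c.Γ n p.fst‖ + ‖c.Dstar n p.snd‖ := norm_add_le _ _
    linarith
  have b2 : ‖(c.J n p).snd‖ ≤ 2 * ‖p‖ := by
    have : ‖(c.J n p).snd‖ ≤ ‖c.D n p.fst‖ + ‖c.Γstar n p.snd‖ := norm_sub_le _ _
    linarith
  nlinarith [norm_nonneg p, norm_nonneg (c.J n p), norm_nonneg (c.J n p).fst,
    norm_nonneg (c.J n p).snd]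

end ChoiceSequence

section BlockOperators

/-- The infinite orthogonal sum of the two-row columns `X n ⊕ Y n`, `n ≥ 0`. -/
abbrev PairSum (X Y : ℕ → Type*)
    [∀ n, NormedAddCommGroup (X n)] [∀ n, InnerProductSpace ℂ (X n)]
    [∀ n, NormedAddCommGroup (Y n)] [∀ n, InnerProductSpace ℂ (Y n)] : Type _ :=
  lp (fun n => WithLp 2 (X n × Y n)) 2

theorem memℓp_two_iff {G : ℕ → Type*} [∀ n, NormedAddCommGroup (G n)] (f : ∀ n, G n) :
    Memℓp f 2 ↔ Summable (fun n => ‖f n‖ ^ 2) := by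
  rw [memℓp_gen_iff (by norm_num)]
  simp

theorem lp_norm_sq {G : ℕ → Type*} [∀ n, NormedAddCommGroup (G n)] (f : lp G 2) :
    ‖f‖ ^ 2 = ∑' n, ‖f n‖ ^ 2 := by
  have := lp.norm_rpow_eq_tsum (p := 2) (by norm_num) f
  simpa using this

/-- The sequence `x, u₀, u₁, …`. -/
def consSeq (X : ℕ → Type*) (x : X 0) (u : ∀ n, X (n + 1)) : ∀ n, X n
  | 0 => x
  | n + 1 => u n

section Regroup

variable {X Y : ℕ → Type*} [∀ n, NormedAddCommGroup (X n)] [∀ n, NormedAddCommGroup (Y n)]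

theorem summable_components {f : ∀ n, WithLp 2 (X n × Y n)} (hf : Memℓp f 2) :
    Summable (fun n => ‖(f n).fst‖ ^ 2) ∧ Summable (fun n => ‖(f n).snd‖ ^ 2) := by
  have h := (memℓp_two_iff _).1 hf
  simp only [WithLp.prod_norm_sq_eq_of_L2] at h
  exact ⟨h.of_nonneg_of_le (fun _ => sq_nonneg _) (fun _ => le_add_of_nonneg_right (sq_nonneg _)),
    h.of_nonneg_of_le (fun _ => sq_nonneg _) (fun _ => le_add_of_nonneg_left (sq_nonneg _))⟩

theorem memℓp_of_components {f : ∀ n, WithLp 2 (X n × Y n)}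
    (h1 : Summable (fun n => ‖(f n).fst‖ ^ 2)) (h2 : Summable (fun n => ‖(f n).snd‖ ^ 2)) :
    Memℓp f 2 := by
  rw [memℓp_two_iff]
  simp only [WithLp.prod_norm_sq_eq_of_L2]
  exact h1.add h2

theorem memℓp_regroup (x : X 0) (f : ∀ n, WithLp 2 (Y n × X (n + 1))) (hf : Memℓp f 2) :
    Memℓp (fun n => WithLp.toLp 2 (consSeq X x (fun k => (f k).snd) n, (f n).fst)) 2 := by
  obtain ⟨h1, h2⟩ := summable_components hf
  refine memℓp_of_components ?_ h1
  exact (summable_nat_add_iff 1).1 h2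

theorem memℓp_regroup_symm (f : ∀ n, WithLp 2 (X n × Y n)) (hf : Memℓp f 2) :
    Memℓp (fun n => WithLp.toLp 2 ((f n).snd, (f (n + 1)).fst)) 2 := by
  obtain ⟨h1, h2⟩ := summable_components hf
  exact memℓp_of_components h2 ((summable_nat_add_iff 1).2 h1)

end Regroup

/-- The block-diagonal operator `⊕ₙ A n` of a uniformly bounded sequence of operators. -/
def blockDiag {G G' : ℕ → Type*}
    [∀ n, NormedAddCommGroup (G n)] [∀ n, InnerProductSpace ℂ (G n)]
    [∀ n, NormedAddCommGroup (G' n)] [∀ n, InnerProductSpace ℂ (G' n)]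
    (A : ∀ n, G n →L[ℂ] G' n) (C : ℝ) (hA : ∀ n x, ‖A n x‖ ≤ C * ‖x‖) :
    lp G 2 →L[ℂ] lp G' 2 :=
  have hsq : ∀ (f : lp G 2) n, ‖A n (f n)‖ ^ 2 ≤ C ^ 2 * ‖f n‖ ^ 2 := fun f n => by
    rw [← mul_pow]; exact pow_le_pow_left₀ (norm_nonneg _) (hA n (f n)) 2
  have hsum : ∀ f : lp G 2, Summable (fun n => C ^ 2 * ‖f n‖ ^ 2) := fun f =>
    ((memℓp_two_iff _).1 (lp.memℓp f)).mul_left _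
  LinearMap.mkContinuous
    { toFun := fun f => ⟨fun n => A n (f n), (memℓp_two_iff _).2
        (Summable.of_nonneg_of_le (fun _ => sq_nonneg _) (hsq f) (hsum f))⟩
      map_add' := fun f g => by ext n; exact map_add (A n) (f n) (g n)
      map_smul' := fun a f => by ext n; exact map_smul (A n) a (f n) }
    |C| (fun f => by
      refine le_of_sq_le_sq ?_ (by positivity)
      rw [mul_pow, sq_abs, lp_norm_sq, lp_norm_sq, ← tsum_mul_left]
      exact Summable.tsum_le_tsum (hsq f)
        (Summable.of_nonneg_of_le (fun _ => sq_nonneg _) (hsq f) (hsum f)) (hsum f))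

/-- Regrouping of an orthogonal sum:
`x ⊕ (y₀ ⊕ x₁) ⊕ (y₁ ⊕ x₂) ⊕ ⋯ = (x ⊕ y₀) ⊕ (x₁ ⊕ y₁) ⊕ (x₂ ⊕ y₂) ⊕ ⋯`. -/
def regroup (X Y : ℕ → Type*)
    [∀ n, NormedAddCommGroup (X n)] [∀ n, InnerProductSpace ℂ (X n)]
    [∀ n, NormedAddCommGroup (Y n)] [∀ n, InnerProductSpace ℂ (Y n)] :
    WithLp 2 (X 0 × PairSum Y (fun n => X (n + 1))) ≃ₗᵢ[ℂ] PairSum X Y where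
  toFun p := ⟨fun n => WithLp.toLp 2 (consSeq X p.fst (fun k => (p.snd k).snd) n, (p.snd n).fst),
    memℓp_regroup _ _ (lp.memℓp p.snd)⟩
  invFun f := WithLp.toLp 2 ((f 0).fst,
    ⟨fun n => WithLp.toLp 2 ((f n).snd, (f (n + 1)).fst), memℓp_regroup_symm _ (lp.memℓp f)⟩)
  left_inv p := by
    refine WithLp.ofLp_injective 2 (Prod.ext rfl ?_)
    exact lp.ext (funext fun _ => rfl)
  right_inv f := by
    refine lp.ext (funext fun n => ?_)
    cases n <;> rfl
  map_add' p q := by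
    refine lp.ext (funext fun n => ?_)
    cases n <;> rfl
  map_smul' a p := by
    refine lp.ext (funext fun n => ?_)
    cases n <;> rfl
  norm_map' p := by
    rw [← sq_eq_sq₀ (norm_nonneg _) (norm_nonneg _), WithLp.prod_norm_sq_eq_of_L2, lp_norm_sq,
      lp_norm_sq]
    obtain ⟨h1, h2⟩ := summable_components (lp.memℓp p.snd)
    have h3 : Summable (fun n => ‖consSeq X p.fst (fun k => (p.snd k).snd) n‖ ^ 2) :=
      (summable_nat_add_iff 1).1 h2
    simp only [WithLp.prod_norm_sq_eq_of_L2]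
    change ∑' n, (‖consSeq X p.fst (fun k => (p.snd k).snd) n‖ ^ 2 + ‖(p.snd n).fst‖ ^ 2) = _
    rw [h3.tsum_add h1, h1.tsum_add h2, h3.tsum_eq_zero_add]
    change ‖p.fst‖ ^ 2 + ∑' n, ‖(p.snd n).snd‖ ^ 2 + _ = _
    ring

end BlockOperators

namespace ChoiceSequence

variable {M N : Type*}
  [NormedAddCommGroup M] [InnerProductSpace ℂ M]
  [NormedAddCommGroup N] [InnerProductSpace ℂ N]

/-- The state space `H₀ = ⊕ₙ (𝔇_{Γ₂ₙ} ⊕ 𝔇_{Γ₂ₙ₊₁*})`. -/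
abbrev H0 (c : ChoiceSequence M N) : Type _ :=
  PairSum (fun n => c.E (2 * n + 1)) (fun n => c.F (2 * (n + 1)))

/-- The state space `H̃₀ = ⊕ₙ (𝔇_{Γ₂ₙ*} ⊕ 𝔇_{Γ₂ₙ₊₁})`. -/
abbrev H0t (c : ChoiceSequence M N) : Type _ :=
  PairSum (fun n => c.F (2 * n + 1)) (fun n => c.E (2 * (n + 1)))

/-- `V₀ = ⊕ₙ J_{Γ₂ₙ₊₁} : H₀ → H̃₀`. -/
def V0 (c : ChoiceSequence M N) : c.H0 →L[ℂ] c.H0t :=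
  blockDiag (fun n => c.J (2 * n + 1)) 4 (fun n => c.norm_J_apply_le (2 * n + 1))

/-- `L₀ = ⊕ₙ J_{Γ₂ₙ} : M ⊕ H̃₀ → N ⊕ H₀`, where `M ⊕ H̃₀` and `N ⊕ H₀` are regrouped as
`(M ⊕ 𝔇_{Γ₀*}) ⊕ (𝔇_{Γ₁} ⊕ 𝔇_{Γ₂*}) ⊕ ⋯` and `(N ⊕ 𝔇_{Γ₀}) ⊕ (𝔇_{Γ₁*} ⊕ 𝔇_{Γ₂}) ⊕ ⋯`.
Here `M` is `E 0` and `N` is `F 0`. -/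
def L0 (c : ChoiceSequence M N) :
    WithLp 2 (c.E (2 * 0) × c.H0t) →L[ℂ] WithLp 2 (c.F (2 * 0) × c.H0) :=
  ((regroup (fun n => c.F (2 * n)) (fun n => c.E (2 * n + 1))).symm.toContinuousLinearEquiv :
      PairSum (fun n => c.F (2 * n)) (fun n => c.E (2 * n + 1)) →L[ℂ] _).comp
    ((blockDiag (fun n => c.J (2 * n)) 4 (fun n => c.norm_J_apply_le (2 * n))).comp
      ((regroup (fun n => c.E (2 * n)) (fun n => c.F (2 * n + 1))).toContinuousLinearEquiv :
        _ →L[ℂ] PairSum (fun n => c.E (2 * n)) (fun n => c.F (2 * n + 1))))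

/-- The operator `I ⊕ A` on `G ⊕ K`. -/
def idSum (G : Type*) {K K' : Type*} [NormedAddCommGroup G] [InnerProductSpace ℂ G]
    [NormedAddCommGroup K] [InnerProductSpace ℂ K]
    [NormedAddCommGroup K'] [InnerProductSpace ℂ K'] (A : K →L[ℂ] K') :
    WithLp 2 (G × K) →L[ℂ] WithLp 2 (G × K') :=
  ((WithLp.prodContinuousLinearEquiv 2 ℂ G K').symm : (G × K') →L[ℂ] WithLp 2 (G × K')).comp
    ((WithLp.fstL 2 ℂ G K).prod (A.comp (WithLp.sndL 2 ℂ G K)))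

/-- The compression to `K` of an operator from `G ⊕ K` to `G' ⊕ K`. -/
def truncate {G G' K : Type*} [NormedAddCommGroup G] [InnerProductSpace ℂ G]
    [NormedAddCommGroup G'] [InnerProductSpace ℂ G']
    [NormedAddCommGroup K] [InnerProductSpace ℂ K]
    (A : WithLp 2 (G × K) →L[ℂ] WithLp 2 (G' × K)) : K →L[ℂ] K :=
  (WithLp.sndL 2 ℂ G' K).comp (A.comp
    (((WithLp.prodContinuousLinearEquiv 2 ℂ G K).symm : (G × K) →L[ℂ] WithLp 2 (G × K)).comp
      (ContinuousLinearMap.inr ℂ G K)))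

/-- `M₀ = I_M ⊕ V₀ : M ⊕ H₀ → M ⊕ H̃₀`. -/
def M0 (c : ChoiceSequence M N) :
    WithLp 2 (c.E (2 * 0) × c.H0) →L[ℂ] WithLp 2 (c.E (2 * 0) × c.H0t) :=
  idSum _ c.V0

/-- `M̃₀ = I_N ⊕ V₀ : N ⊕ H₀ → N ⊕ H̃₀`. -/
def M0t (c : ChoiceSequence M N) :
    WithLp 2 (c.F (2 * 0) × c.H0) →L[ℂ] WithLp 2 (c.F (2 * 0) × c.H0t) :=
  idSum _ c.V0

/-- The block operator CMV matrix `U₀ = L₀ M₀ : M ⊕ H₀ → N ⊕ H₀`. -/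
def U0 (c : ChoiceSequence M N) :
    WithLp 2 (c.E (2 * 0) × c.H0) →L[ℂ] WithLp 2 (c.F (2 * 0) × c.H0) :=
  c.L0.comp c.M0

/-- The block operator CMV matrix `Ũ₀ = M̃₀ L₀ : M ⊕ H̃₀ → N ⊕ H̃₀`. -/
def U0t (c : ChoiceSequence M N) :
    WithLp 2 (c.E (2 * 0) × c.H0t) →L[ℂ] WithLp 2 (c.F (2 * 0) × c.H0t) :=
  c.M0t.comp c.L0

/-- The truncated block operator CMV matrix `T₀`, the compression of `U₀` to `H₀`. -/
def T0 (c : ChoiceSequence M N) : c.H0 →L[ℂ] c.H0 := truncate c.U0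

/-- The truncated block operator CMV matrix `T̃₀`, the compression of `Ũ₀` to `H̃₀`. -/
def T0t (c : ChoiceSequence M N) : c.H0t →L[ℂ] c.H0t := truncate c.U0t

end ChoiceSequence

end BlockCMV

end

noncomputable section

namespace BlockCMV

open ContinuousLinearMap (adjoint)

/-! ### Defect operators: intertwining, factorization through defect spaces, and the rotation
identity. -/

section Operators

variable {H₁ H₂ : Type*}
  [NormedAddCommGroup H₁] [InnerProductSpace ℂ H₁] [CompleteSpace H₁]
  [NormedAddCommGroup H₂] [InnerProductSpace ℂ H₂] [CompleteSpace H₂]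

/-! The Schur algorithm factors Θ into an infinite cascade of the rotations J of its Schur
parameters. The block CMV matrix is that cascade written as one unitary operator on (external space)
⊕ (state space), and its transfer function is Θ. The characteristic function of the adjoint of the
state operator is then Θ again, once purity removes the superfluous part of the external spaces.

Existence of the parameters. Put Γ = Θ(0). Every Taylor coefficient of positive order satisfies |⟨w,
Θₙ x⟩| ≤ ‖D_Γ x‖ ‖D_{Γ*} w‖ (`norm_inner_taylorCoeff_le`), an averaged form of contractivity.
Douglas factorization gives Θ(z) = Γ + z D_{Γ*} Y(z) D_Γ (`IsSchurClass.exists_defect_form`). Since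
J_Γ is isometric, ‖Θ(z)x‖ ≤ ‖x‖ becomes ‖zY(z)d‖ ≤ ‖(1 - zΓ*Y(z))d‖. Hence the next iterate Y(1 -
zΓ*Y)⁻¹ exists, and it is contractive by the maximum principle (`IsSchurClass.exists_schur_step`).
Iteration gives all parameters.

Unitarity. J_Γ is unitary with inverse J_{Γ*}, by T D_T = D_{T*} T. Passing to inverses reverses the
product of the two block-diagonal factors, so U₀ of {Γₙ} is inverse to Ũ₀ of {Γₙ*}, and Ũ₀ to U₀.
Thus T̃₀ of {Γₙ*} is the adjoint of T₀ of {Γₙ}, and T₀ of {Γₙ*} the adjoint of T̃₀ of {Γₙ}.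

Transfer function. Running the recursion from x₀ yields vectors xₙ and yₙ = Θₙ(z)xₙ with Jₙ(xₙ, z
yₙ₊₁) = (yₙ, xₙ₊₁) and uniformly bounded norms. Weighted by powers of z they form a square summable
state h with U(x₀, zh) = (Θ(z)x₀, h), for both CMV matrices. `IsUnitaryPair.coincide_charFun` turns
this identity into coincidence of the characteristic function with Θ.

Complete non-unitarity. On a reducing subspace where T₀ is unitary nothing leaks to the external
spaces. The zeros there propagate through the rotations, since D_{Γ*} is injective on its defect
space, and annihilate every coordinate. -/

theorem eq_zero_of_comp_eq_neg_comp {Z : H₁ →L[ℂ] H₂} {P : H₁ →L[ℂ] H₁} {Q : H₂ →L[ℂ] H₂}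
    (hP : 0 ≤ P) (hQ : 0 ≤ Q) (h : ∀ x, Q (Z x) = -Z (P x)) (x : H₁) :
    Z (P x) = 0 ∧ Q (Z x) = 0 := by
  have hZ : (adjoint Z).comp (Q.comp Z) = -((adjoint Z).comp Z * P) := by
    ext x; simp [h]
  have hpos : 0 ≤ (adjoint Z).comp (Q.comp Z) := by
    rw [ContinuousLinearMap.nonneg_iff_isPositive] at hQ ⊢
    exact hQ.adjoint_conj Z
  have hZZ : 0 ≤ (adjoint Z).comp Z := by
    rw [ContinuousLinearMap.nonneg_iff_isPositive]
    exact ContinuousLinearMap.isPositive_adjoint_comp_self Z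
  have hsa : IsSelfAdjoint ((adjoint Z).comp Z * P) := by
    have h1 := IsSelfAdjoint.of_nonneg hpos
    rw [hZ] at h1
    simpa using h1.neg
  -- A self-adjoint product of two nonnegative operators has commuting factors and is nonnegative.
  -- Here Z*ZP also equals -Z*QZ ≤ 0, so it vanishes.
  have hcomm : Commute ((adjoint Z).comp Z) P :=
    ((IsSelfAdjoint.of_nonneg hZZ).commute_iff (IsSelfAdjoint.of_nonneg hP)).2 hsa
  have h0 : (adjoint Z).comp Z * P = 0 := by
    refine le_antisymm ?_ (hcomm.mul_nonneg hZZ hP)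
    rw [hZ] at hpos
    exact neg_nonneg.1 hpos
  have h1 : Z (P x) = 0 := by
    have h2 : adjoint Z (Z (P x)) = 0 := congrArg (fun A : H₁ →L[ℂ] H₁ => A x) h0
    rw [← inner_self_eq_zero (𝕜 := ℂ), ← ContinuousLinearMap.adjoint_inner_left, h2,
      inner_zero_left]
  exact ⟨h1, by rw [h, h1, neg_zero]⟩

/-- The intertwining relation `T D_T = D_{T*} T`. -/
theorem apply_defectOp {T : H₁ →L[ℂ] H₂} (hT : ‖T‖ ≤ 1) (x : H₁) :
    T (defectOp T x) = defectOp (adjoint T) (T x) := by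
  -- From D_{T*}² T = T D_T² the difference Z satisfies D_{T*} Z = -Z D_T, so both products vanish.
  -- Then Z*Z = -D_T T* Z, hence Z Z*Z = 0 and Z = 0. This replaces approximation of the square root
  -- by polynomials.
  set Z : H₁ →L[ℂ] H₂ := (defectOp (adjoint T)).comp T - T.comp (defectOp T) with hZdef
  have hZx : ∀ x, Z x = defectOp (adjoint T) (T x) - T (defectOp T x) := fun x => rfl
  have key := eq_zero_of_comp_eq_neg_comp (Z := Z) (P := defectOp T) (Q := defectOp (adjoint T))
    (CFC.sqrt_nonneg _) (CFC.sqrt_nonneg _) (fun x => by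
      rw [hZx, hZx, map_sub, defectOp_defectOp (norm_adjoint_le hT), defectOp_defectOp hT,
        ContinuousLinearMap.adjoint_adjoint, map_sub]
      abel)
  have h1 : ∀ x, adjoint Z (Z x) = -(defectOp T (adjoint T (Z x))) := by
    intro x
    refine ext_inner_right ℂ fun v => ?_
    rw [ContinuousLinearMap.adjoint_inner_left, hZx v, inner_sub_right, ← defectOp_isSelfAdjoint,
      (key x).2, inner_zero_left, zero_sub, inner_neg_left, defectOp_isSelfAdjoint,
      ContinuousLinearMap.adjoint_inner_left]
  have h2 : ∀ x, Z (adjoint Z (Z x)) = 0 := fun x => by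
    rw [h1, map_neg, (key _).1, neg_zero]
  have h3 : ∀ x, adjoint Z (Z x) = 0 := fun x => by
    rw [← inner_self_eq_zero (𝕜 := ℂ), ContinuousLinearMap.adjoint_inner_right, h2,
      inner_zero_left]
  have h4 : Z x = 0 := by
    rw [← inner_self_eq_zero (𝕜 := ℂ), ← ContinuousLinearMap.adjoint_inner_left, h3,
      inner_zero_left]
  rw [hZx] at h4
  exact (sub_eq_zero.1 h4).symm

theorem adjoint_defectOp {T : H₁ →L[ℂ] H₂} (hT : ‖T‖ ≤ 1) (y : H₂) :
    adjoint T (defectOp (adjoint T) y) = defectOp T (adjoint T y) := by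
  have := apply_defectOp (norm_adjoint_le hT) y
  rwa [ContinuousLinearMap.adjoint_adjoint] at this

/-- The defect operator as an operator into the defect space. -/
def defectMap (T : H₁ →L[ℂ] H₂) : H₁ →L[ℂ] defectSpace T :=
  (defectOp T).codRestrict _ (defectOp_mem T)

@[simp] theorem coe_defectMap (T : H₁ →L[ℂ] H₂) (x : H₁) :
    (defectMap T x : H₁) = defectOp T x := rfl

theorem denseRange_defectMap (T : H₁ →L[ℂ] H₂) : DenseRange (defectMap T) := by
  rw [DenseRange, dense_iff_closure_eq, Set.eq_univ_iff_forall]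
  rintro ⟨x, hx⟩
  rw [closure_subtype]
  have : Subtype.val '' Set.range (defectMap T) = Set.range (defectOp T) := by
    rw [← Set.range_comp]; rfl
  rw [this]
  exact hx

theorem inner_defectMap (T : H₁ →L[ℂ] H₂) (x : H₁) (d : defectSpace T) :
    ⟪defectMap T x, d⟫_ℂ = ⟪x, defectOp T d⟫_ℂ :=
  defectOp_isSelfAdjoint T x d

theorem eq_zero_of_mem_of_defectOp_eq_zero {T : H₁ →L[ℂ] H₂} {x : H₁} (hx : x ∈ defectSpace T)
    (h : defectOp T x = 0) : x = 0 :=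
  inner_self_eq_zero.1 ((mem_defectSpace_iff T x).1 hx x h)

/-- Douglas factorization of an operator that is dominated by an operator with dense range. -/
theorem exists_comp_eq_of_norm_le {H K L : Type*} [NormedAddCommGroup H] [NormedSpace ℂ H]
    [NormedAddCommGroup K] [NormedSpace ℂ K] [NormedAddCommGroup L] [NormedSpace ℂ L]
    [CompleteSpace L] (A : H →L[ℂ] L) (S : H →L[ℂ] K) (hS : DenseRange S)
    (h : ∀ x, ‖A x‖ ≤ ‖S x‖) : ∃ B : K →L[ℂ] L, ‖B‖ ≤ 1 ∧ ∀ x, B (S x) = A x := by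
  have hn : ∀ x, ‖(A : H →ₗ[ℂ] L) x‖ ≤ 1 * ‖(S : H →ₗ[ℂ] K) x‖ := fun x => by simpa using h x
  exact ⟨(A : H →ₗ[ℂ] L).extendOfNorm (S : H →ₗ[ℂ] K),
    LinearMap.opNorm_extendOfNorm_le hS zero_le_one hn,
    fun x => LinearMap.extendOfNorm_eq hS ⟨1, hn⟩ x⟩

/-- A sesquilinear form dominated by defect operators factors through the defect spaces. -/
theorem exists_defect_factorization {T : H₁ →L[ℂ] H₂} (hT : ‖T‖ ≤ 1) (A : H₁ →L[ℂ] H₂)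
    (h : ∀ x w, ‖⟪w, A x⟫_ℂ‖ ≤ ‖defectOp T x‖ * ‖defectOp (adjoint T) w‖) :
    ∃ K : defectSpace T →L[ℂ] defectSpace (adjoint T), ‖K‖ ≤ 1 ∧
      ∀ x, A x = defectOp (adjoint T) (K (defectMap T x)) := by
  -- Taking w = A x gives ‖Ax‖² ≤ ‖D_T x‖ ‖Ax‖, which factors A as B D_T.
  obtain ⟨B, -, hB⟩ := exists_comp_eq_of_norm_le A (defectMap T) (denseRange_defectMap T)
    (fun x => by
      have h1 := h x (A x)
      rw [inner_self_eq_norm_sq_to_K] at h1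
      have h2 := norm_defectOp_apply_le (norm_adjoint_le hT) (A x)
      have h3 : ‖A x‖ ^ 2 ≤ ‖defectOp T x‖ * ‖defectOp (adjoint T) (A x)‖ := by simpa using h1
      change ‖A x‖ ≤ ‖defectOp T x‖
      have h4 : ‖A x‖ * ‖A x‖ ≤ ‖defectOp T x‖ * ‖A x‖ := by
        nlinarith [norm_nonneg (defectOp T x)]
      rcases (norm_nonneg (A x)).eq_or_lt with h0 | h0
      · rw [← h0]; exact norm_nonneg _
      · exact le_of_mul_le_mul_right h4 h0)
  have hB2 : ∀ w, ∀ d, ‖⟪w, B d⟫_ℂ‖ ≤ ‖d‖ * ‖defectOp (adjoint T) w‖ := by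
    intro w
    refine (denseRange_defectMap T).induction ?_ (isClosed_le (by fun_prop) (by fun_prop))
    rintro _ ⟨x, rfl⟩
    rw [hB]; exact h x w
  -- By density the bound holds for B on the whole defect space. Taking d = B*w gives ‖B*w‖ ≤
  -- ‖D_{T*} w‖, so B* = C D_{T*} and K = C*.
  obtain ⟨C, hC1, hC⟩ := exists_comp_eq_of_norm_le (adjoint B) (defectMap (adjoint T))
    (denseRange_defectMap _) (fun w => by
      have h1 := hB2 w (adjoint B w)
      rw [← ContinuousLinearMap.adjoint_inner_left, inner_self_eq_norm_sq_to_K] at h1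
      have h3 : ‖adjoint B w‖ ^ 2 ≤ ‖adjoint B w‖ * ‖defectOp (adjoint T) w‖ := by simpa using h1
      change _ ≤ ‖defectOp (adjoint T) w‖
      rcases (norm_nonneg (adjoint B w)).eq_or_lt with h0 | h0
      · rw [← h0]; exact norm_nonneg _
      · rw [sq] at h3; exact le_of_mul_le_mul_left h3 h0)
  refine ⟨adjoint C, norm_adjoint_le hC1, fun x => ?_⟩
  rw [← hB]
  refine ext_inner_left ℂ fun w => ?_
  rw [← ContinuousLinearMap.adjoint_inner_left, ← hC, ← inner_defectMap,
    ContinuousLinearMap.adjoint_inner_right]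

theorem exists_linearIsometryEquiv_of_norm_eq {H K L : Type*} [NormedAddCommGroup H]
    [NormedSpace ℂ H] [NormedAddCommGroup K] [NormedSpace ℂ K] [CompleteSpace K]
    [NormedAddCommGroup L] [NormedSpace ℂ L] [CompleteSpace L] (S : H →L[ℂ] K) (A : H →L[ℂ] L)
    (hS : DenseRange S) (hA : DenseRange A) (h : ∀ x, ‖A x‖ = ‖S x‖) :
    ∃ e : K ≃ₗᵢ[ℂ] L, ∀ x, e (S x) = A x :=
  ⟨(LinearEquiv.refl ℂ H).extendOfIsometry (S : H →ₗ[ℂ] K) (A : H →ₗ[ℂ] L) hS hA h,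
    fun x => LinearEquiv.extendOfIsometry_eq _ _ _ hS hA h x⟩

/-- This is the isometry of J_T: the two cross terms cancel because T D_T = D_{T*} T. -/
theorem norm_row_sq {T : H₁ →L[ℂ] H₂} (hT : ‖T‖ ≤ 1) (x : H₁) (y : H₂) :
    ‖T x + defectOp (adjoint T) y‖ ^ 2 + ‖defectOp T x - adjoint T y‖ ^ 2
      = ‖x‖ ^ 2 + ‖y‖ ^ 2 := by
  have h1 := norm_add_sq (𝕜 := ℂ) (T x) (defectOp (adjoint T) y)
  have h2 := norm_sub_sq (𝕜 := ℂ) (defectOp T x) (adjoint T y)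
  have h3 : ⟪defectOp T x, adjoint T y⟫_ℂ = ⟪T x, defectOp (adjoint T) y⟫_ℂ := by
    rw [ContinuousLinearMap.adjoint_inner_right, apply_defectOp hT, defectOp_isSelfAdjoint]
  have h4 := norm_defectOp_sq hT x
  have h5 := norm_defectOp_sq (norm_adjoint_le hT) y
  rw [h3] at h2
  rw [h1, h2, h4, h5]; ring

end Operators

/-! ### One step of the Schur algorithm: coefficient bounds, the defect form and Möbius inversion.
-/

section SchurStep

open Metric Real

variable {H₁ H₂ : Type*}
  [NormedAddCommGroup H₁] [InnerProductSpace ℂ H₁] [CompleteSpace H₁]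
  [NormedAddCommGroup H₂] [InnerProductSpace ℂ H₂] [CompleteSpace H₂]

/-- The Taylor coefficients at the origin. -/
def taylorCoeff {E : Type*} [NormedAddCommGroup E] [NormedSpace ℂ E] (f : ℂ → E) (n : ℕ) : E :=
  (n.factorial : ℂ)⁻¹ • iteratedDeriv n f 0

theorem circleAverage_inv_pow_smul {E : Type*} [NormedAddCommGroup E] [NormedSpace ℂ E]
    [CompleteSpace E] {f : ℂ → E} {r : ℝ} (hr : 0 < r) (hf : DifferentiableOn ℂ f (closedBall 0 r))
    (n : ℕ) : circleAverage (fun z => (z ^ n)⁻¹ • f z) 0 r = taylorCoeff f n := by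
  rw [circleAverage_eq_circleIntegral hr.ne']
  have h := hf.circleIntegral_one_div_sub_center_pow_smul hr n
  have h2 : (∮ z in C(0, r), (z - 0)⁻¹ • (z ^ n)⁻¹ • f z)
      = ∮ z in C(0, r), (1 / (z - 0) ^ (n + 1)) • f z := by
    congr 1; ext z
    rw [smul_smul, sub_zero, pow_succ, one_div, mul_inv, mul_comm]
  rw [h2, h, smul_smul, taylorCoeff]
  congr 1
  have : (2 * π * Complex.I : ℂ) ≠ 0 := Complex.two_pi_I_ne_zero
  field_simp

omit [CompleteSpace H₁] in
theorem circleAverage_inner_coeff {Θ : ℂ → H₁ →L[ℂ] H₂} {r : ℝ} (hr : 0 < r)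
    (hΘ : DifferentiableOn ℂ Θ (closedBall 0 r)) (n : ℕ) (w : H₂) (x : H₁) :
    CircleIntegrable (fun z => (z ^ n)⁻¹ * ⟪w, Θ z x⟫_ℂ) 0 r ∧
    circleAverage (fun z => (z ^ n)⁻¹ * ⟪w, Θ z x⟫_ℂ) 0 r = ⟪w, taylorCoeff Θ n x⟫_ℂ := by
  have hint : CircleIntegrable (fun z => (z ^ n)⁻¹ • Θ z) 0 r := by
    refine ContinuousOn.circleIntegrable hr.le ?_
    refine ContinuousOn.smul (ContinuousOn.inv₀ (f := fun z : ℂ => z ^ n) (by fun_prop) ?_)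
      (hΘ.continuousOn.mono sphere_subset_closedBall)
    intro z hz
    exact pow_ne_zero _ (ne_of_mem_sphere hz hr.ne')
  let L : (H₁ →L[ℂ] H₂) →L[ℝ] ℂ :=
    ((innerSL ℂ w).comp (ContinuousLinearMap.apply ℂ H₂ x)).restrictScalars ℝ
  have hL : (fun z => (z ^ n)⁻¹ * ⟪w, Θ z x⟫_ℂ) = L ∘ fun z => (z ^ n)⁻¹ • Θ z := by
    ext z; simp [L]
  rw [hL]
  refine ⟨?_, ?_⟩
  · exact ⟨L.integrable_comp hint.1, L.integrable_comp hint.2⟩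
  · rw [ContinuousLinearMap.circleAverage_comp_comm L hint, circleAverage_inv_pow_smul hr hΘ]
    simp [L]

theorem taylorCoeff_zero {E : Type*} [NormedAddCommGroup E] [NormedSpace ℂ E] (f : ℂ → E) :
    taylorCoeff f 0 = f 0 := by
  simp [taylorCoeff]

omit [CompleteSpace H₁] in
theorem re_inner_le_half (a b : H₁) : RCLike.re ⟪a, b⟫_ℂ ≤ (‖a‖ ^ 2 + ‖b‖ ^ 2) / 2 := by
  have h := re_inner_le_norm (𝕜 := ℂ) a b
  nlinarith [sq_nonneg (‖a‖ - ‖b‖)]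

omit [CompleteSpace H₁] in
theorem norm_add_smul_sq (c : ℂ) (a b : H₁) :
    ‖a + c • b‖ ^ 2 = ‖a‖ ^ 2 + 2 * (c * ⟪a, b⟫_ℂ).re + ‖c‖ ^ 2 * ‖b‖ ^ 2 := by
  rw [norm_add_sq (𝕜 := ℂ), inner_smul_right, norm_smul, mul_pow]
  rfl

/-- The estimate averages Re⟨u + zⁿw, Θ(z)(x + zⁿv)⟩ ≤ (‖u + zⁿw‖² + ‖x + zⁿv‖²)/2 over |z| = r. The
choice u = Θ(0)x, v = Θ(0)*w makes the averaged terms combine into defect norms. -/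
theorem re_inner_taylorCoeff_le_of_radius {Θ : ℂ → H₁ →L[ℂ] H₂} (hΘ : IsSchurClass Θ) {n : ℕ}
    (hn : n ≠ 0) {r : ℝ} (hr : 0 < r) (hr1 : r < 1) (x : H₁) (w : H₂) :
    (r ^ n) ^ 2 * (⟪w, taylorCoeff Θ n x⟫_ℂ).re ≤
      (‖defectOp (Θ 0) x‖ ^ 2 + (r ^ n) ^ 2 * ‖defectOp (adjoint (Θ 0)) w‖ ^ 2) / 2 := by
  have hsub : closedBall (0 : ℂ) r ⊆ ball 0 1 := closedBall_subset_ball hr1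
  have hd : DifferentiableOn ℂ Θ (closedBall 0 r) := hΘ.holomorphic.mono hsub
  have h0 : ‖Θ 0‖ ≤ 1 := hΘ.contractive 0 (by simp)
  set u := Θ 0 x with hu
  set v := adjoint (Θ 0) w with hv
  set ρ : ℝ := (r ^ n) ^ 2 with hρ
  obtain ⟨hint, havg⟩ := circleAverage_inner_coeff hr hd n w x
  -- The pairing splits on the circle into a holomorphic part and the term `q` with z⁻ⁿ, because the
  -- conjugate of zⁿ is ρz⁻ⁿ. The subtracted bracket absorbs the cross terms of the two squared
  -- norms and vanishes at the origin since n ≠ 0.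
  let p : ℂ → ℂ := fun z =>
    ⟪u, Θ z x⟫_ℂ + z ^ n * (⟪u, Θ z v⟫_ℂ - (⟪u, w⟫_ℂ + ⟪x, v⟫_ℂ)) + ρ * ⟪w, Θ z v⟫_ℂ
  have hinner : ∀ (a : H₂) (b : H₁), DifferentiableOn ℂ (fun z => ⟪a, Θ z b⟫_ℂ) (closedBall 0 r) :=
    fun a b => (innerSL ℂ a).differentiable.comp_differentiableOn
      (hd.clm_apply (differentiableOn_const b))
  have hp : DifferentiableOn ℂ p (closedBall 0 r) :=
    ((hinner u x).add (((differentiable_id.pow n).differentiableOn).mul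
      ((hinner u v).sub (differentiableOn_const _)))).add ((hinner w v).const_mul _)
  have hpint : CircleIntegrable p 0 r :=
    (hp.continuousOn.mono sphere_subset_closedBall).circleIntegrable hr.le
  have hpavg : circleAverage p 0 r = p 0 := by
    apply DiffContOnCl.circleAverage
    rw [abs_of_pos hr]
    exact (hp.mono closure_ball_subset_closedBall).diffContOnCl
  let q : ℂ → ℂ := fun z => (ρ : ℂ) • ((z ^ n)⁻¹ * ⟪w, Θ z x⟫_ℂ)
  have hqint : CircleIntegrable q 0 r := hint.const_fun_smul
  have hqavg : circleAverage q 0 r = ρ * ⟪w, taylorCoeff Θ n x⟫_ℂ := by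
    -- The average of `q` extracts the n-th Taylor coefficient by Cauchy's formula.
    rw [← havg, ← smul_eq_mul]
    exact circleAverage_fun_smul
  have havg2 : circleAverage (p + q) 0 r = p 0 + ρ * ⟪w, taylorCoeff Θ n x⟫_ℂ := by
    rw [circleAverage_add hpint hqint, hpavg, hqavg]
  have hle : circleAverage (Complex.reCLM ∘ (p + q)) 0 r ≤
      (‖u‖ ^ 2 + ρ * ‖w‖ ^ 2 + ‖x‖ ^ 2 + ρ * ‖v‖ ^ 2) / 2 := by
    refine circleAverage_mono_on_of_le_circle ?_ ?_
    · exact ⟨Complex.reCLM.integrable_comp (hpint.add hqint).1,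
        Complex.reCLM.integrable_comp (hpint.add hqint).2⟩
    · intro z hz
      rw [abs_of_pos hr] at hz
      have hzr : ‖z‖ = r := by simpa using hz
      have hz1 : z ∈ ball (0 : ℂ) 1 := hsub (sphere_subset_closedBall hz)
      have hz0 : z ^ n ≠ 0 := pow_ne_zero _ (ne_of_mem_sphere hz hr.ne')
      have hconj : (starRingEnd ℂ) (z ^ n) = ρ * (z ^ n)⁻¹ := by
        rw [eq_mul_inv_iff_mul_eq₀ hz0, mul_comm, Complex.mul_conj, Complex.normSq_eq_norm_sq,
          norm_pow, hzr]
      have h1 := re_inner_le_half (u + z ^ n • w) (Θ z (x + z ^ n • v))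
      have h2 : ‖Θ z (x + z ^ n • v)‖ ≤ ‖x + z ^ n • v‖ := by
        simpa using (Θ z).le_of_opNorm_le (hΘ.contractive z hz1) (x + z ^ n • v)
      have h3 := pow_le_pow_left₀ (norm_nonneg _) h2 2
      rw [norm_add_smul_sq] at h1 h3
      rw [norm_pow, hzr, ← hρ] at h1 h3
      have h4 : ⟪u + z ^ n • w, Θ z (x + z ^ n • v)⟫_ℂ
          = (p + q) z + z ^ n * ⟪u, w⟫_ℂ + z ^ n * ⟪x, v⟫_ℂ := by
        simp only [map_add, map_smul, inner_add_left, inner_add_right, inner_smul_left,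
          inner_smul_right, hconj, Pi.add_apply, p, q, smul_eq_mul]
        field_simp
        ring
      rw [h4] at h1
      simp only [RCLike.re_to_complex, Complex.add_re] at h1
      simp only [Function.comp_apply, Complex.reCLM_apply]
      linarith
  rw [ContinuousLinearMap.circleAverage_comp_comm _ (hpint.add hqint), havg2] at hle
  have hp0 : p 0 = ((‖u‖ ^ 2 + ρ * ‖v‖ ^ 2 : ℝ) : ℂ) := by
    have : ⟪w, Θ 0 v⟫_ℂ = ((‖v‖ ^ 2 : ℝ) : ℂ) := by
      rw [← ContinuousLinearMap.adjoint_inner_left, ← hv, inner_self_eq_norm_sq_to_K]; simp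
    simp only [p, this, ← hu, inner_self_eq_norm_sq_to_K, zero_pow hn]
    push_cast
    simp
  rw [hp0, Complex.reCLM_apply, Complex.add_re, Complex.ofReal_re, Complex.re_ofReal_mul] at hle
  have e1 := norm_defectOp_sq h0 x
  have e2 := norm_defectOp_sq (norm_adjoint_le h0) w
  rw [e1, e2]
  linarith

theorem re_inner_taylorCoeff_le {Θ : ℂ → H₁ →L[ℂ] H₂} (hΘ : IsSchurClass Θ) {n : ℕ}
    (hn : n ≠ 0) (x : H₁) (w : H₂) :
    (⟪w, taylorCoeff Θ n x⟫_ℂ).re ≤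
      (‖defectOp (Θ 0) x‖ ^ 2 + ‖defectOp (adjoint (Θ 0)) w‖ ^ 2) / 2 := by
  set a := (⟪w, taylorCoeff Θ n x⟫_ℂ).re
  set b := ‖defectOp (Θ 0) x‖ ^ 2
  set d := ‖defectOp (adjoint (Θ 0)) w‖ ^ 2
  have h : ∀ r ∈ Set.Ioo (0 : ℝ) 1, (r ^ n) ^ 2 * a ≤ (b + (r ^ n) ^ 2 * d) / 2 := fun r hr =>
    re_inner_taylorCoeff_le_of_radius hΘ hn hr.1 hr.2 x w
  have hc : ∀ r ∈ closure (Set.Ioo (0 : ℝ) 1), (r ^ n) ^ 2 * a ≤ (b + (r ^ n) ^ 2 * d) / 2 :=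
    closure_minimal h (isClosed_le (f := fun r : ℝ => (r ^ n) ^ 2 * a)
      (g := fun r : ℝ => (b + (r ^ n) ^ 2 * d) / 2) (by fun_prop) (by fun_prop))
  rw [closure_Ioo zero_ne_one] at hc
  simpa using hc 1 (by simp)

/-- Replacing x by t·conj(α)x in the additive bound gives a quadratic in the real variable t that is
never negative. Its discriminant condition is the product bound. -/
theorem norm_inner_taylorCoeff_le {Θ : ℂ → H₁ →L[ℂ] H₂} (hΘ : IsSchurClass Θ) {n : ℕ}
    (hn : n ≠ 0) (x : H₁) (w : H₂) :
    ‖⟪w, taylorCoeff Θ n x⟫_ℂ‖ ≤ ‖defectOp (Θ 0) x‖ * ‖defectOp (adjoint (Θ 0)) w‖ := by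
  set α := ⟪w, taylorCoeff Θ n x⟫_ℂ with hα
  set b := ‖defectOp (Θ 0) x‖ with hb
  set d := ‖defectOp (adjoint (Θ 0)) w‖ with hd
  have key : ∀ t : ℝ, 0 ≤ (‖α‖ ^ 2 * b ^ 2) * (t * t) + (-(2 * ‖α‖ ^ 2)) * t + d ^ 2 := by
    intro t
    have h := re_inner_taylorCoeff_le hΘ hn (((t : ℂ) * starRingEnd ℂ α) • x) w
    rw [map_smul, map_smul, inner_smul_right, norm_smul, ← hα, ← hb, ← hd, mul_assoc,
      mul_comm (starRingEnd ℂ α), Complex.mul_conj, Complex.normSq_eq_norm_sq, norm_mul,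
      Complex.norm_real, RCLike.norm_conj, ← Complex.ofReal_mul, Complex.ofReal_re, mul_pow,
      mul_pow, Real.norm_eq_abs, sq_abs] at h
    linarith
  have hdisc := discrim_le_zero key
  rw [discrim] at hdisc
  rcases (norm_nonneg α).eq_or_lt with h0 | h0
  · rw [← h0]; positivity
  · refine le_of_sq_le_sq ?_ (by positivity)
    have h1 : ‖α‖ ^ 2 * (4 * ‖α‖ ^ 2) ≤ ‖α‖ ^ 2 * (4 * (b * d) ^ 2) := by linarith
    have h2 := le_of_mul_le_mul_left h1 (by positivity)
    linarith

/-- A power series with coefficients in the unit ball is holomorphic in the unit disk. -/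
theorem exists_hasSum_pow_smul {E : Type*} [NormedAddCommGroup E] [NormedSpace ℂ E]
    [CompleteSpace E] (a : ℕ → E) (ha : ∀ n, ‖a n‖ ≤ 1) :
    ∃ f : ℂ → E, DifferentiableOn ℂ f (ball 0 1) ∧
      ∀ z ∈ ball (0 : ℂ) 1, HasSum (fun n => z ^ n • a n) (f z) := by
  have hle : ∀ (n : ℕ) (z : ℂ), ‖z ^ n • a n‖ ≤ ‖z‖ ^ n := fun n z => by
    rw [norm_smul, norm_pow]
    exact mul_le_of_le_one_right (by positivity) (ha n)
  refine ⟨fun z => ∑' n, z ^ n • a n, ?_, fun z hz => (Summable.of_norm_bounded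
    (summable_geometric_of_lt_one (norm_nonneg z) (by simpa using hz)) fun n => hle n z).hasSum⟩
  intro z hz
  obtain ⟨r, hr1, hr2⟩ := exists_between (show ‖z‖ < 1 by simpa using hz)
  have hd : DifferentiableOn ℂ (fun z : ℂ => ∑' n, z ^ n • a n) (ball 0 r) := by
    refine Complex.differentiableOn_tsum_of_summable_norm
      (summable_geometric_of_lt_one ((norm_nonneg z).trans hr1.le) hr2)
      (fun n => ((differentiable_id.pow n).smul_const (a n)).differentiableOn) isOpen_ball ?_
    intro n w hw
    exact (hle n w).trans (pow_le_pow_left₀ (norm_nonneg _)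
      (show ‖w‖ < r by simpa using hw).le n)
  exact (hd.differentiableAt (isOpen_ball.mem_nhds (by simpa using hr1))).differentiableWithinAt

-- Once each coefficient of positive order factors through contractions between fixed outer
-- operators, the power series of the middle factors converges in the disk and the factorization can
-- be summed termwise.
omit [CompleteSpace H₁] in
theorem exists_holomorphic_factor {K L : Type*} [NormedAddCommGroup K] [NormedSpace ℂ K]
    [NormedAddCommGroup L] [NormedSpace ℂ L] [CompleteSpace L] {Θ : ℂ → H₁ →L[ℂ] H₂}
    (hΘ : DifferentiableOn ℂ Θ (ball 0 1)) (S : H₁ →L[ℂ] K) (R : L →L[ℂ] H₂)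
    (A : ℕ → K →L[ℂ] L) (hA : ∀ n, ‖A n‖ ≤ 1)
    (h : ∀ n x, taylorCoeff Θ (n + 1) x = R (A n (S x))) :
    ∃ Y : ℂ → K →L[ℂ] L, DifferentiableOn ℂ Y (ball 0 1) ∧ ∀ z ∈ ball (0 : ℂ) 1, ∀ x,
      Θ z x = Θ 0 x + z • R (Y z (S x)) := by
  obtain ⟨Y, hYd, hY⟩ := exists_hasSum_pow_smul A hA
  refine ⟨Y, hYd, fun z hz x => ?_⟩
  have hT2 : HasSum (fun n => z ^ n • taylorCoeff Θ n x) (Θ z x) := by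
    have := (ContinuousLinearMap.apply ℂ H₂ x).hasSum (Complex.hasSum_taylorSeries_on_ball hΘ hz)
    rw [ContinuousLinearMap.apply_apply] at this
    convert this using 2 with n
    simp [taylorCoeff, smul_smul, mul_comm]
  have hY2 := (R.hasSum ((ContinuousLinearMap.apply ℂ L (S x)).hasSum (hY z hz))).const_smul z
  have hY3 : HasSum (fun n => z ^ (n + 1) • taylorCoeff Θ (n + 1) x) (z • R (Y z (S x))) := by
    rw [ContinuousLinearMap.apply_apply] at hY2
    convert hY2 using 2 with n
    simp [h, smul_smul, pow_succ']
  have := ((hasSum_nat_add_iff' 1).2 hT2).unique hY3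
  simp only [Finset.range_one, Finset.sum_singleton, pow_zero, one_smul, taylorCoeff_zero] at this
  rw [sub_eq_iff_eq_add'] at this
  exact this

/-- A Schur class function has the form `Γ + z D_{Γ*} Y(z) D_Γ`, where `Γ` is its value at the
origin and `Y` is holomorphic in the disk. -/
theorem IsSchurClass.exists_defect_form {Θ : ℂ → H₁ →L[ℂ] H₂} (hΘ : IsSchurClass Θ) :
    ∃ Y : ℂ → defectSpace (Θ 0) →L[ℂ] defectSpace (adjoint (Θ 0)),
      DifferentiableOn ℂ Y (ball 0 1) ∧ ∀ z ∈ ball (0 : ℂ) 1, ∀ x,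
        Θ z x = Θ 0 x + z • defectOp (adjoint (Θ 0)) (Y z (defectMap (Θ 0) x)) := by
  have h0 : ‖Θ 0‖ ≤ 1 := hΘ.contractive 0 (by simp)
  choose K hK1 hK using fun n : ℕ => exists_defect_factorization h0 (taylorCoeff Θ (n + 1))
    (norm_inner_taylorCoeff_le hΘ n.succ_ne_zero)
  exact exists_holomorphic_factor hΘ.holomorphic (defectMap (Θ 0))
    ((defectOp (adjoint (Θ 0))).comp (defectSpace (adjoint (Θ 0))).subtypeL) K hK1 hK

/-- Expanding ‖d - (1 - X)d‖² ≤ ‖(1 - X)d‖² gives ‖d‖² ≤ 2 Re⟨d, (1 - X)d⟩, so 1 - X is coercive and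
therefore invertible. -/
theorem isUnit_one_sub_of_norm_le {K : Type*} [NormedAddCommGroup K] [InnerProductSpace ℂ K]
    [CompleteSpace K] (X : K →L[ℂ] K) (h : ∀ d, ‖X d‖ ≤ ‖(1 - X) d‖) : IsUnit (1 - X) := by
  refine ContinuousLinearMap.isUnit_of_forall_le_norm_inner_map _ (c := 1 / 2) (by norm_num) ?_
  intro d
  have h1 := pow_le_pow_left₀ (norm_nonneg _) (h d) 2
  have h2 : X d = d - (1 - X) d := by simp
  rw [h2, norm_sub_sq (𝕜 := ℂ)] at h1
  have h3 := RCLike.re_le_norm ⟪d, (1 - X) d⟫_ℂ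
  rw [norm_inner_symm]
  rw [show ((1 / 2 : NNReal) : ℝ) = 1 / 2 by norm_num]
  linarith

theorem differentiableOn_comp_inverse {K L : Type*} [NormedAddCommGroup K] [NormedSpace ℂ K]
    [CompleteSpace K] [NormedAddCommGroup L] [NormedSpace ℂ L] {Y : ℂ → K →L[ℂ] L} {s : Set ℂ}
    (hY : DifferentiableOn ℂ Y s) (G : L →L[ℂ] K)
    (hu : ∀ z ∈ s, IsUnit (1 - z • G.comp (Y z))) :
    DifferentiableOn ℂ (fun z => (Y z).comp (Ring.inverse (1 - z • G.comp (Y z)))) s := by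
  refine hY.clm_comp fun z hz => ?_
  have hX : DifferentiableOn ℂ (fun z => z • G.comp (Y z)) s :=
    differentiableOn_id.smul ((differentiableOn_const G).clm_comp hY)
  exact (differentiableAt_inverse (𝕜 := ℂ) (hu z hz)).comp_differentiableWithinAt z
    (((differentiableOn_const (1 : K →L[ℂ] K)).sub hX) z hz)

/-- A holomorphic function with `‖z f z‖ ≤ 1` in the unit disk is bounded by one. -/
theorem norm_le_one_of_norm_smul_le {E : Type*} [NormedAddCommGroup E] [NormedSpace ℂ E]
    {f : ℂ → E} (hf : DifferentiableOn ℂ f (ball 0 1))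
    (h : ∀ z ∈ ball (0 : ℂ) 1, ‖z • f z‖ ≤ 1) {z : ℂ} (hz : z ∈ ball (0 : ℂ) 1) : ‖f z‖ ≤ 1 := by
  have hz1 : ‖z‖ < 1 := by simpa using hz
  -- The maximum principle on the disk of radius r gives ‖f(z)‖ ≤ 1/r; then r tends to 1.
  have key : ∀ r ∈ Set.Ioo ‖z‖ 1, r * ‖f z‖ ≤ 1 := by
    intro r hr
    have hr0 : 0 < r := (norm_nonneg z).trans_lt hr.1
    have hb := Complex.norm_le_of_forall_mem_frontier_norm_le (C := r⁻¹)
      (isBounded_ball (x := (0 : ℂ)) (r := r))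
      (hf.mono (closure_ball_subset_closedBall.trans (closedBall_subset_ball hr.2))).diffContOnCl
      (fun w hw => by
        rw [frontier_ball _ hr0.ne'] at hw
        have hw1 : ‖w‖ = r := by simpa using hw
        have := h w (by simpa [hw1] using hr.2)
        rw [norm_smul, hw1] at this
        rw [← one_div, le_div_iff₀ hr0]
        linarith)
      (z := z) (subset_closure (by simpa using hr.1))
    have := mul_le_mul_of_nonneg_left hb hr0.le
    rwa [mul_inv_cancel₀ hr0.ne'] at this
  have hc : ∀ r ∈ closure (Set.Ioo ‖z‖ 1), r * ‖f z‖ ≤ 1 :=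
    closure_minimal key (isClosed_le (f := fun r : ℝ => r * ‖f z‖) (g := fun _ => 1)
      (by fun_prop) (by fun_prop))
  rw [closure_Ioo hz1.ne] at hc
  simpa using hc 1 ⟨hz1.le, le_rfl⟩

/-- One step of the Schur algorithm. -/
theorem IsSchurClass.exists_schur_step {Θ : ℂ → H₁ →L[ℂ] H₂} (hΘ : IsSchurClass Θ) :
    ∃ Ω : ℂ → defectSpace (Θ 0) →L[ℂ] defectSpace (adjoint (Θ 0)), IsSchurClass Ω ∧
      ∀ z ∈ ball (0 : ℂ) 1, ∀ x, ∃ d : defectSpace (Θ 0),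
        (d : H₁) + adjoint (Θ 0) (z • Ω z d) = defectOp (Θ 0) x ∧
        Θ z x = Θ 0 x + defectOp (adjoint (Θ 0)) (z • Ω z d) := by
  have h0 : ‖Θ 0‖ ≤ 1 := hΘ.contractive 0 (by simp)
  obtain ⟨Y, hYd, hY⟩ := hΘ.exists_defect_form
  let G : defectSpace (adjoint (Θ 0)) →L[ℂ] defectSpace (Θ 0) :=
    ((adjoint (Θ 0)).comp (defectSpace (adjoint (Θ 0))).subtypeL).codRestrict _ (fun y => by
      have h := apply_mem_defectSpace (norm_adjoint_le h0) y.2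
      rwa [ContinuousLinearMap.adjoint_adjoint] at h)
  have hGn : ∀ y, ‖G y‖ ≤ ‖y‖ := fun y => by
    have := (adjoint (Θ 0)).le_of_opNorm_le (norm_adjoint_le h0) y
    rwa [one_mul] at this
  let X : ℂ → defectSpace (Θ 0) →L[ℂ] defectSpace (Θ 0) := fun z => z • G.comp (Y z)
  -- On d = D_Γ x, the rotation identity reads ‖Θ(z)x‖² + ‖(1 - X)d‖² = ‖x‖² + ‖zYd‖², and ‖Θ(z)x‖ ≤
  -- ‖x‖. Density extends the inequality to the defect space.
  have hle : ∀ z ∈ ball (0 : ℂ) 1, ∀ d, ‖z • Y z d‖ ≤ ‖(1 - X z) d‖ := by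
    intro z hz
    refine (denseRange_defectMap (Θ 0)).induction ?_ (isClosed_le (by fun_prop) (by fun_prop))
    rintro _ ⟨x, rfl⟩
    have h1 := norm_row_sq h0 x (z • Y z (defectMap (Θ 0) x))
    have h2 : ‖Θ z x‖ ≤ ‖x‖ := by
      simpa using (Θ z).le_of_opNorm_le (hΘ.contractive z hz) x
    rw [hY z hz] at h2
    have h3 := pow_le_pow_left₀ (norm_nonneg _) h2 2
    rw [map_smul, map_smul] at h1
    have h4 : ‖(1 - X z) (defectMap (Θ 0) x)‖
        = ‖defectOp (Θ 0) x - z • adjoint (Θ 0) (Y z (defectMap (Θ 0) x))‖ := rfl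
    rw [h4]
    refine le_of_sq_le_sq ?_ (norm_nonneg _)
    have h5 : ‖z • Y z (defectMap (Θ 0) x)‖
      = ‖z • (Y z (defectMap (Θ 0) x) : H₂)‖ := rfl
    rw [h5]
    linarith
  have hunit : ∀ z ∈ ball (0 : ℂ) 1, IsUnit (1 - X z) := fun z hz =>
    isUnit_one_sub_of_norm_le (X z) fun d => by
      refine le_trans ?_ (hle z hz d)
      have : X z d = G (z • Y z d) := by simp [X]
      rw [this]
      exact hGn _
  -- This inverts the Möbius transformation: for d = (1 - X)D_Γ x one has Ωd = Y D_Γ x, hence d +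
  -- zΓ*Ωd = D_Γ x.
  let Ω : ℂ → defectSpace (Θ 0) →L[ℂ] defectSpace (adjoint (Θ 0)) :=
    fun z => (Y z).comp (Ring.inverse (1 - X z))
  have hinv : ∀ z ∈ ball (0 : ℂ) 1, ∀ d, (1 - X z) (Ring.inverse (1 - X z) d) = d := fun z hz d =>
    congrArg (fun A : defectSpace (Θ 0) →L[ℂ] defectSpace (Θ 0) => A d)
      (Ring.mul_inverse_cancel _ (hunit z hz))
  have hinv' : ∀ z ∈ ball (0 : ℂ) 1, ∀ d, Ring.inverse (1 - X z) ((1 - X z) d) = d :=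
    fun z hz d => congrArg (fun A : defectSpace (Θ 0) →L[ℂ] defectSpace (Θ 0) => A d)
      (Ring.inverse_mul_cancel _ (hunit z hz))
  have hΩd : DifferentiableOn ℂ Ω (ball 0 1) := differentiableOn_comp_inverse hYd G hunit
  refine ⟨Ω, ⟨hΩd, fun z hz => norm_le_one_of_norm_smul_le hΩd (fun w hw => ?_) hz⟩,
    fun z hz x => ⟨(1 - X z) (defectMap (Θ 0) x), ?_, ?_⟩⟩
  · refine ContinuousLinearMap.opNorm_le_bound _ zero_le_one fun d => ?_
    have := hle w hw (Ring.inverse (1 - X w) d)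
    rw [hinv w hw] at this
    rw [one_mul]
    exact this
  · have : Ω z ((1 - X z) (defectMap (Θ 0) x)) = Y z (defectMap (Θ 0) x) := by
      simp only [Ω, ContinuousLinearMap.comp_apply, hinv' z hz]
    rw [this]
    have h2 : (((1 - X z) (defectMap (Θ 0) x) : defectSpace (Θ 0)) : H₁)
      = defectOp (Θ 0) x - z • adjoint (Θ 0) (Y z (defectMap (Θ 0) x)) := rfl
    rw [h2]
    simp
  · have : Ω z ((1 - X z) (defectMap (Θ 0) x)) = Y z (defectMap (Θ 0) x) := by
      simp only [Ω, ContinuousLinearMap.comp_apply, hinv' z hz]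
    rw [this, hY z hz]
    simp

end SchurStep

/-! ### The Möbius relation between consecutive iterates, without operator inverses. -/

namespace ChoiceSequence

variable {M N : Type*}
  [NormedAddCommGroup M] [InnerProductSpace ℂ M]
  [NormedAddCommGroup N] [InnerProductSpace ℂ N]

theorem norm_Γstar_apply_le (c : ChoiceSequence M N) (n : ℕ) (y : c.F (n + 1)) :
    ‖c.Γstar n y‖ ≤ ‖y‖ := by
  have := (adjoint (c.Γ n)).le_of_opNorm_le (norm_adjoint_le (c.contractive n)) (c.inclF n y)
  rw [one_mul] at this
  exact this

theorem isUnit_one_add {K L : Type*} [NormedAddCommGroup K] [NormedSpace ℂ K] [CompleteSpace K]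
    [NormedAddCommGroup L] [NormedSpace ℂ L] (G : L →L[ℂ] K) (hG : ∀ y, ‖G y‖ ≤ ‖y‖)
    (W : K →L[ℂ] L) (hW : ‖W‖ ≤ 1) {z : ℂ} (hz : z ∈ Metric.ball (0 : ℂ) 1) :
    IsUnit (1 + G.comp (z • W)) := by
  rw [← sub_neg_eq_add]
  refine isUnit_one_sub_of_norm_lt_one ?_
  rw [norm_neg]
  have hz1 : ‖z‖ < 1 := by simpa using hz
  refine lt_of_le_of_lt (ContinuousLinearMap.opNorm_le_bound _ (norm_nonneg z) fun x => ?_) hz1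
  refine (hG _).trans ?_
  change ‖z • W x‖ ≤ ‖z‖ * ‖x‖
  rw [norm_smul]
  have := W.le_of_opNorm_le hW x
  gcongr
  rwa [one_mul] at this

/-- The Möbius representation of a Schur iterate, evaluated at a vector. -/
theorem moebius_iff (c : ChoiceSequence M N) (n : ℕ) (A : c.E n →L[ℂ] c.F n)
    (W : c.E (n + 1) →L[ℂ] c.F (n + 1)) (hW : ‖W‖ ≤ 1) {z : ℂ} (hz : z ∈ Metric.ball (0 : ℂ) 1) :
    A = c.Γ n + (c.Dstar n).comp ((z • W).comp
        ((Ring.inverse (1 + (c.Γstar n).comp (z • W))).comp (c.D n))) ↔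
    ∀ x, ∃ d, d + c.Γstar n (z • W d) = c.D n x ∧ A x = c.Γ n x + c.Dstar n (z • W d) := by
  have hu := isUnit_one_add (c.Γstar n) (c.norm_Γstar_apply_le n) W hW hz
  have h1 : ∀ d, (1 + (c.Γstar n).comp (z • W)) (Ring.inverse (1 + (c.Γstar n).comp (z • W)) d)
      = d := fun d => congrArg (fun B : c.E (n + 1) →L[ℂ] c.E (n + 1) => B d)
        (Ring.mul_inverse_cancel _ hu)
  have h2 : ∀ d, Ring.inverse (1 + (c.Γstar n).comp (z • W)) ((1 + (c.Γstar n).comp (z • W)) d)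
      = d := fun d => congrArg (fun B : c.E (n + 1) →L[ℂ] c.E (n + 1) => B d)
        (Ring.inverse_mul_cancel _ hu)
  constructor
  · rintro rfl x
    exact ⟨Ring.inverse (1 + (c.Γstar n).comp (z • W)) (c.D n x), h1 _, rfl⟩
  · intro h
    ext1 x
    obtain ⟨d, hd, hA⟩ := h x
    have hd2 : Ring.inverse (1 + (c.Γstar n).comp (z • W)) (c.D n x) = d := by
      rw [← hd]; exact h2 d
    rw [hA, add_apply, ContinuousLinearMap.comp_apply,
      ContinuousLinearMap.comp_apply, ContinuousLinearMap.comp_apply, hd2]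
    rfl

end ChoiceSequence

/-! ### Existence of Schur parameters by iterating the Schur step. -/

section Existence

variable {M N : Type*}
  [NormedAddCommGroup M] [InnerProductSpace ℂ M]
  [NormedAddCommGroup N] [InnerProductSpace ℂ N]

/-- A Schur class function between closed subspaces, as it occurs in the Schur algorithm. -/
structure SchurStage (M N : Type*)
    [NormedAddCommGroup M] [InnerProductSpace ℂ M]
    [NormedAddCommGroup N] [InnerProductSpace ℂ N] where
  -- Recording every defect space as a subspace of the fixed M or N keeps the recursion in a single
  -- type.
  E : Submodule ℂ M
  F : Submodule ℂ N
  [completeE : CompleteSpace E]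
  [completeF : CompleteSpace F]
  θ : ℂ → E →L[ℂ] F
  schur : IsSchurClass θ

attribute [instance] SchurStage.completeE SchurStage.completeF

/-- A subspace of a subspace, as a subspace of the whole space. -/
def mapSubtypeEquiv (E : Submodule ℂ M) (K : Submodule ℂ E) : K ≃ₗᵢ[ℂ] K.map E.subtype :=
  { Submodule.equivMapOfInjective E.subtype E.injective_subtype K with
    norm_map' := fun _ => rfl }

@[simp] theorem coe_mapSubtypeEquiv (E : Submodule ℂ M) (K : Submodule ℂ E) (x : K) :
    (mapSubtypeEquiv E K x : M) = ((x : E) : M) := rfl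

namespace SchurStage

/-- The next Schur iterate, as a function between the defect spaces. -/
def iterate (s : SchurStage M N) :
    ℂ → defectSpace (s.θ 0) →L[ℂ] defectSpace (adjoint (s.θ 0)) :=
  s.schur.exists_schur_step.choose

theorem iterate_spec (s : SchurStage M N) : IsSchurClass s.iterate ∧
    ∀ z ∈ Metric.ball (0 : ℂ) 1, ∀ x, ∃ d : defectSpace (s.θ 0),
      (d : s.E) + adjoint (s.θ 0) (z • s.iterate z d) = defectOp (s.θ 0) x ∧
      s.θ z x = s.θ 0 x + defectOp (adjoint (s.θ 0)) (z • s.iterate z d) :=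
  s.schur.exists_schur_step.choose_spec

theorem isSchurClass_conj {K L K' L' : Type*}
    [NormedAddCommGroup K] [InnerProductSpace ℂ K] [CompleteSpace K]
    [NormedAddCommGroup L] [InnerProductSpace ℂ L] [CompleteSpace L]
    [NormedAddCommGroup K'] [InnerProductSpace ℂ K'] [CompleteSpace K']
    [NormedAddCommGroup L'] [InnerProductSpace ℂ L'] [CompleteSpace L']
    {Ω : ℂ → K →L[ℂ] L} (h : IsSchurClass Ω) (A : L →ₗᵢ[ℂ] L') (B : K' →ₗᵢ[ℂ] K) :
    IsSchurClass fun z => A.toContinuousLinearMap.comp ((Ω z).comp B.toContinuousLinearMap) := by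
  refine ⟨(differentiableOn_const _).clm_comp (h.holomorphic.clm_comp (differentiableOn_const _)),
    fun z hz => ContinuousLinearMap.opNorm_le_bound _ zero_le_one fun x => ?_⟩
  have := (Ω z).le_of_opNorm_le (h.contractive z hz) (B x)
  simpa using this

theorem completeSpace_map (E : Submodule ℂ M) (K : Submodule ℂ E) [CompleteSpace K] :
    CompleteSpace (K.map E.subtype) :=
  (completeSpace_congr (e := (mapSubtypeEquiv E K).toEquiv)
    (mapSubtypeEquiv E K).isometry.isUniformEmbedding).1 inferInstance

/-- One step of the Schur algorithm. -/
def next (s : SchurStage M N) : SchurStage M N where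
  E := (defectSpace (s.θ 0)).map s.E.subtype
  F := (defectSpace (adjoint (s.θ 0))).map s.F.subtype
  completeE := completeSpace_map _ _
  completeF := completeSpace_map _ _
  θ z :=
    (mapSubtypeEquiv s.F (defectSpace (adjoint (s.θ 0)))).toLinearIsometry.toContinuousLinearMap.comp
    ((s.iterate z).comp
      (mapSubtypeEquiv s.E (defectSpace (s.θ 0))).symm.toLinearIsometry.toContinuousLinearMap)
  schur :=
    haveI := completeSpace_map s.E (defectSpace (s.θ 0))
    haveI := completeSpace_map s.F (defectSpace (adjoint (s.θ 0)))
    isSchurClass_conj s.iterate_spec.1 _ _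

/-- The Schur algorithm. -/
def iter (s : SchurStage M N) : ℕ → SchurStage M N
  | 0 => s
  | n + 1 => (iter s n).next

/-- The values at the origin of the Schur iterates, as a choice sequence. -/
def choiceSequence (s : SchurStage M N) (hE : s.E = ⊤) (hF : s.F = ⊤) : ChoiceSequence M N where
  E n := (s.iter n).E
  F n := (s.iter n).F
  Γ n := (s.iter n).θ 0
  contractive n := (s.iter n).schur.contractive 0 (by simp)
  E_zero := hE
  F_zero := hF
  E_succ _ := rfl
  F_succ _ := rfl

/-- The relation of `iterate_spec` is transported along the identification of a subspace of a
subspace with its image in M or N, which leaves the underlying vectors unchanged. -/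
theorem choiceSequence_moebius (s : SchurStage M N) (hE : s.E = ⊤) (hF : s.F = ⊤) (n : ℕ) {z : ℂ}
    (hz : z ∈ Metric.ball (0 : ℂ) 1) (x : (s.choiceSequence hE hF).E n) :
    ∃ d : (s.choiceSequence hE hF).E (n + 1),
      d + (s.choiceSequence hE hF).Γstar n (z • (s.iter (n + 1)).θ z d)
        = (s.choiceSequence hE hF).D n x ∧
      (s.iter n).θ z x = (s.choiceSequence hE hF).Γ n x
        + (s.choiceSequence hE hF).Dstar n (z • (s.iter (n + 1)).θ z d) := by
  obtain ⟨d, hd1, hd2⟩ := (s.iter n).iterate_spec.2 z hz x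
  have hθ : (s.iter (n + 1)).θ z (mapSubtypeEquiv (s.iter n).E _ d)
      = mapSubtypeEquiv (s.iter n).F _ ((s.iter n).iterate z d) := by
    change mapSubtypeEquiv (s.iter n).F _ ((s.iter n).iterate z
      ((mapSubtypeEquiv (s.iter n).E _).symm (mapSubtypeEquiv (s.iter n).E _ d))) = _
    rw [LinearIsometryEquiv.symm_apply_apply]
  refine ⟨mapSubtypeEquiv (s.iter n).E _ d, ?_, ?_⟩
  · rw [hθ]
    have h := congrArg (s.iter n).E.subtype hd1
    exact Subtype.ext h
  · rw [hθ, hd2]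
    rfl

end SchurStage

/-- Every Schur class function has a sequence of Schur parameters. -/
theorem IsSchurClass.exists_isSchurParametersOf [CompleteSpace M] [CompleteSpace N]
    {Θ : ℂ → M →L[ℂ] N} (hΘ : IsSchurClass Θ) :
    ∃ c : ChoiceSequence M N, c.IsSchurParametersOf Θ := by
  let eM := LinearIsometryEquiv.ofTop M (⊤ : Submodule ℂ M) rfl
  let eN := LinearIsometryEquiv.ofTop N (⊤ : Submodule ℂ N) rfl
  have : CompleteSpace (⊤ : Submodule ℂ M) :=
    (isClosed_univ : IsClosed ((⊤ : Submodule ℂ M) : Set M)).completeSpace_coe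
  have : CompleteSpace (⊤ : Submodule ℂ N) :=
    (isClosed_univ : IsClosed ((⊤ : Submodule ℂ N) : Set N)).completeSpace_coe
  let s : SchurStage M N :=
    { E := ⊤
      F := ⊤
      θ := fun z => eN.symm.toLinearIsometry.toContinuousLinearMap.comp
        ((Θ z).comp eM.toLinearIsometry.toContinuousLinearMap)
      schur := SchurStage.isSchurClass_conj hΘ _ _ }
  refine ⟨s.choiceSequence rfl rfl, fun n => (s.iter n).θ, fun n => (s.iter n).schur,
    fun z _ x => rfl, fun n => rfl, fun n z hz => ?_⟩
  exact ((s.choiceSequence rfl rfl).moebius_iff n _ _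
    ((s.iter (n + 1)).schur.contractive z hz) hz).2 fun x => s.choiceSequence_moebius rfl rfl n hz x

end Existence

open ChoiceSequence (truncate)

/-! ### Complete non-unitarity under passage to the adjoint. -/

section CompletelyNonUnitary

variable {H : Type*} [NormedAddCommGroup H] [InnerProductSpace ℂ H] [CompleteSpace H]

theorem IsCompletelyNonUnitary.adjoint {T : H →L[ℂ] H} (hT : IsCompletelyNonUnitary T) :
    IsCompletelyNonUnitary (adjoint T) := by
  refine ⟨norm_adjoint_le hT.1, fun K hK h1 h2 h3 => hT.2 K hK ?_ h1 fun x hx => ?_⟩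
  · simpa using h2
  · simpa [and_comm] using h3 x hx

end CompletelyNonUnitary

/-! ### Unitary operators carried together with an explicit inverse. -/

section UnitaryPair

variable {X Y Z : Type*}
  [NormedAddCommGroup X] [InnerProductSpace ℂ X]
  [NormedAddCommGroup Y] [InnerProductSpace ℂ Y]
  [NormedAddCommGroup Z] [InnerProductSpace ℂ Z]

/-- `W` is the inverse and the adjoint of `U`. -/
structure IsUnitaryPair (U : X →L[ℂ] Y) (W : Y →L[ℂ] X) : Prop where
  left_inv : ∀ p, W (U p) = p
  right_inv : ∀ q, U (W q) = q
  inner_left : ∀ p q, ⟪U p, q⟫_ℂ = ⟪p, W q⟫_ℂ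

namespace IsUnitaryPair

theorem symm {U : X →L[ℂ] Y} {W : Y →L[ℂ] X} (h : IsUnitaryPair U W) : IsUnitaryPair W U where
  left_inv := h.right_inv
  right_inv := h.left_inv
  inner_left p q := by rw [← inner_conj_symm, ← h.inner_left, inner_conj_symm]

theorem comp {U : X →L[ℂ] Y} {W : Y →L[ℂ] X} {U' : Y →L[ℂ] Z} {W' : Z →L[ℂ] Y}
    (h' : IsUnitaryPair U' W') (h : IsUnitaryPair U W) :
    IsUnitaryPair (U'.comp U) (W.comp W') where
  left_inv p := by simp [h.left_inv, h'.left_inv]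
  right_inv p := by simp [h.right_inv, h'.right_inv]
  inner_left p q := by simp [h.inner_left, h'.inner_left]

theorem of_linearIsometryEquiv (e : X ≃ₗᵢ[ℂ] Y) :
    IsUnitaryPair (e.toContinuousLinearEquiv : X →L[ℂ] Y)
      (e.symm.toContinuousLinearEquiv : Y →L[ℂ] X) where
  left_inv := e.symm_apply_apply
  right_inv := e.apply_symm_apply
  inner_left p q := by
    rw [← e.inner_map_map p]
    exact congrArg (inner ℂ (e p)) (e.apply_symm_apply q).symm

theorem norm_map {U : X →L[ℂ] Y} {W : Y →L[ℂ] X} (h : IsUnitaryPair U W) (p : X) :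
    ‖U p‖ = ‖p‖ := by
  rw [@norm_eq_sqrt_re_inner ℂ, @norm_eq_sqrt_re_inner ℂ _ _ _ _ p, h.inner_left, h.left_inv]

theorem idSum {U : X →L[ℂ] Y} {W : Y →L[ℂ] X} (h : IsUnitaryPair U W) :
    IsUnitaryPair (ChoiceSequence.idSum Z U) (ChoiceSequence.idSum Z W) where
  left_inv p := WithLp.ofLp_injective 2 (Prod.ext rfl (h.left_inv p.snd))
  right_inv p := WithLp.ofLp_injective 2 (Prod.ext rfl (h.right_inv p.snd))
  inner_left p q := by
    rw [WithLp.prod_inner_apply, WithLp.prod_inner_apply]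
    exact congrArg (inner ℂ p.fst q.fst + ·) (h.inner_left p.snd q.snd)

theorem blockDiag {G G' : ℕ → Type*}
    [∀ n, NormedAddCommGroup (G n)] [∀ n, InnerProductSpace ℂ (G n)]
    [∀ n, NormedAddCommGroup (G' n)] [∀ n, InnerProductSpace ℂ (G' n)]
    {A : ∀ n, G n →L[ℂ] G' n} {B : ∀ n, G' n →L[ℂ] G n} {C C' : ℝ}
    (hA : ∀ n x, ‖A n x‖ ≤ C * ‖x‖) (hB : ∀ n x, ‖B n x‖ ≤ C' * ‖x‖)
    (h : ∀ n, IsUnitaryPair (A n) (B n)) :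
    IsUnitaryPair (BlockCMV.blockDiag A C hA) (BlockCMV.blockDiag B C' hB) where
  left_inv f := lp.ext (funext fun n => (h n).left_inv (f n))
  right_inv f := lp.ext (funext fun n => (h n).right_inv (f n))
  inner_left f g := by
    rw [lp.inner_eq_tsum, lp.inner_eq_tsum]
    exact tsum_congr fun n => (h n).inner_left (f n) (g n)

end IsUnitaryPair

end UnitaryPair

/-! ### Unitary colligations and the characteristic function of the state operator. -/

section Colligation

variable {G G' H : Type*}
  [NormedAddCommGroup G] [InnerProductSpace ℂ G]
  [NormedAddCommGroup G'] [InnerProductSpace ℂ G']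
  [NormedAddCommGroup H] [InnerProductSpace ℂ H]

/-- The compression of an operator from `G ⊕ H` to `G' ⊕ H` to an operator from `H` to `G'`. -/
def outputOp (A : WithLp 2 (G × H) →L[ℂ] WithLp 2 (G' × H)) : H →L[ℂ] G' :=
  (WithLp.fstL 2 ℂ G' H).comp (A.comp
    (((WithLp.prodContinuousLinearEquiv 2 ℂ G H).symm : (G × H) →L[ℂ] WithLp 2 (G × H)).comp
      (ContinuousLinearMap.inr ℂ G H)))

namespace IsUnitaryPair

variable {U : WithLp 2 (G × H) →L[ℂ] WithLp 2 (G' × H)}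
  {W : WithLp 2 (G' × H) →L[ℂ] WithLp 2 (G × H)}

theorem apply_inr (A : WithLp 2 (G × H) →L[ℂ] WithLp 2 (G' × H)) (x : H) :
    A (WithLp.toLp 2 (0, x)) = WithLp.toLp 2 (outputOp A x, truncate A x) := rfl

theorem norm_sq_inr (h : IsUnitaryPair U W) (x : H) :
    ‖outputOp U x‖ ^ 2 + ‖truncate U x‖ ^ 2 = ‖x‖ ^ 2 := by
  have h1 := h.norm_map (WithLp.toLp 2 (0, x))
  have h2 := WithLp.prod_norm_sq_eq_of_L2 (WithLp.toLp 2 ((0 : G), x))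
  have h3 := WithLp.prod_norm_sq_eq_of_L2 (U (WithLp.toLp 2 (0, x)))
  rw [h1, h2] at h3
  simpa [apply_inr] using h3.symm

theorem norm_truncate_le (h : IsUnitaryPair U W) : ‖truncate U‖ ≤ 1 :=
  ContinuousLinearMap.opNorm_le_bound _ zero_le_one fun x => by
    have := h.norm_sq_inr x
    rw [one_mul]
    exact le_of_sq_le_sq (by nlinarith [sq_nonneg ‖outputOp U x‖]) (norm_nonneg _)

theorem inner_truncate (h : IsUnitaryPair U W) (x y : H) :
    ⟪truncate U x, y⟫_ℂ = ⟪x, truncate W y⟫_ℂ := by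
  have := h.inner_left (WithLp.toLp 2 (0, x)) (WithLp.toLp 2 (0, y))
  rw [apply_inr, apply_inr, WithLp.prod_inner_apply, WithLp.prod_inner_apply] at this
  simpa using this

variable [CompleteSpace H]

theorem adjoint_truncate (h : IsUnitaryPair U W) : adjoint (truncate U) = truncate W :=
  ((ContinuousLinearMap.eq_adjoint_iff _ _).2 fun x y => by
    rw [← inner_conj_symm, ← h.inner_truncate, inner_conj_symm]).symm

/-- Unitarity of U splits ‖x‖² between state and output, so the output has the norm of D_T x. Hence
the output operator is the defect operator up to an isometry. -/
theorem norm_outputOp (h : IsUnitaryPair U W) (x : H) :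
    ‖outputOp U x‖ = ‖defectMap (truncate U) x‖ := by
  have h1 := h.norm_sq_inr x
  have h2 := norm_defectOp_sq h.norm_truncate_le x
  rw [← sq_eq_sq₀ (norm_nonneg _) (norm_nonneg _)]
  change _ = ‖defectOp (truncate U) x‖ ^ 2
  linarith

-- A vector y orthogonal to all outputs of U is one whose image W(y, 0) has no state component,
-- because W is the adjoint of U.
omit [CompleteSpace H] in
theorem denseRange_outputOp [CompleteSpace G'] (h : IsUnitaryPair U W)
    (hinj : ∀ y : G', (W (WithLp.toLp 2 (y, 0))).snd = 0 → y = 0) : DenseRange (outputOp U) := by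
  have : (outputOp U).range.topologicalClosure = ⊤ := by
    rw [Submodule.topologicalClosure_eq_top_iff, Submodule.eq_bot_iff]
    intro y hy
    refine hinj y (ext_inner_left ℂ fun x => ?_)
    have h1 := (Submodule.mem_orthogonal _ _).1 hy (outputOp U x) ⟨x, rfl⟩
    have h2 := h.inner_left (WithLp.toLp 2 (0, x)) (WithLp.toLp 2 (y, 0))
    rw [apply_inr, WithLp.prod_inner_apply, WithLp.prod_inner_apply] at h2
    simp only [inner_zero_left, inner_zero_right, zero_add, add_zero] at h2
    rw [inner_zero_right]
    exact h2.symm.trans h1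
  rw [← Submodule.dense_iff_topologicalClosure_eq_top] at this
  exact this

/-- With T the state operator of W = U⁻¹, the outputs of W and U realize D_T and D_{T*} up to
unitaries e and e', purity making their ranges dense. Eliminating the state y from the transfer
identity gives (1 - zT*)y = D_T² k and θ(z) e D_T k = e' D_{T*}(zy - Tk), which is the
characteristic function applied to D_T k. -/
theorem coincide_charFun [CompleteSpace G] [CompleteSpace G'] (h : IsUnitaryPair U W)
    (θ : ℂ → G →L[ℂ] G')
    (hθ : ∀ z ∈ Metric.ball (0 : ℂ) 1, ∀ x, ∃ y : H,
      U (WithLp.toLp 2 (x, z • y)) = WithLp.toLp 2 (θ z x, y))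
    (hpure : ∀ x, ‖θ 0 x‖ = ‖x‖ → x = 0) (hT : ‖truncate W‖ ≤ 1) :
    Coincide (charFun (truncate W) hT) θ := by
  set T := truncate W with hTdef
  have hTU : adjoint T = truncate U := h.symm.adjoint_truncate
  have hzero : ∀ x, U (WithLp.toLp 2 (x, 0)) = WithLp.toLp 2
      (θ 0 x, (U (WithLp.toLp 2 (x, 0))).snd) := by
    intro x
    obtain ⟨y, hy⟩ := hθ 0 (by simp) x
    rw [zero_smul] at hy
    rw [hy]
    rfl
  have hinjU : ∀ x : G, (U (WithLp.toLp 2 (x, 0))).snd = 0 → x = 0 := by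
    intro x hx
    have h1 := hzero x
    rw [hx] at h1
    have h2 := h.norm_map (WithLp.toLp 2 (x, 0))
    rw [h1] at h2
    exact hpure x (by simpa using h2)
  -- Purity at the origin also controls the output side: if W(y, 0) = (x, 0), then U(x, 0) = (y, 0)
  -- has no state component, so x = 0 and y = 0.
  have hinjW : ∀ y : G', (W (WithLp.toLp 2 (y, 0))).snd = 0 → y = 0 := by
    intro y hy
    set x := (W (WithLp.toLp 2 (y, 0))).fst with hx
    have h1 : W (WithLp.toLp 2 (y, 0)) = WithLp.toLp 2 (x, 0) :=
      WithLp.ofLp_injective 2 (Prod.ext rfl hy)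
    have h2 : U (WithLp.toLp 2 (x, 0)) = WithLp.toLp 2 (y, 0) := by rw [← h1, h.right_inv]
    have h3 : x = 0 := hinjU x (by rw [h2]; rfl)
    have h4 := h.symm.norm_map (WithLp.toLp 2 (y, 0))
    rw [h1, h3] at h4
    simpa using h4.symm
  obtain ⟨e, he⟩ := exists_linearIsometryEquiv_of_norm_eq (defectMap T) (outputOp W)
    (denseRange_defectMap T) (h.symm.denseRange_outputOp hinjU) h.symm.norm_outputOp
  obtain ⟨e', he'⟩ := exists_linearIsometryEquiv_of_norm_eq (defectMap (adjoint T)) (outputOp U)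
    (denseRange_defectMap _) (h.denseRange_outputOp hinjW) (by rw [hTU]; exact h.norm_outputOp)
  refine ⟨e', e.symm, fun z hz x => ?_⟩
  suffices hs : ∀ d, e' (charFun T hT z d) = θ z (e d) by
    rw [hs, LinearIsometryEquiv.apply_symm_apply]
  have hcont : Continuous fun d => θ z (e d) := (θ z).continuous.comp e.continuous
  have hcont' : Continuous fun d => e' (charFun T hT z d) :=
    e'.continuous.comp (charFun T hT z).continuous
  refine (denseRange_defectMap T).induction ?_ (isClosed_eq hcont' hcont)
  rintro _ ⟨k, rfl⟩
  rw [he]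
  obtain ⟨y, hy⟩ := hθ z hz (outputOp W k)
  have hk : U (WithLp.toLp 2 (outputOp W k, T k)) = WithLp.toLp 2 (0, k) := by
    rw [hTdef, ← apply_inr W k, h.right_inv]
  -- Subtracting U(W(0, k)) = (0, k) from the transfer identity cancels the external input, so only
  -- the compressions of U to the state space remain.
  have hsub : U (WithLp.toLp 2 (0, z • y - T k)) = WithLp.toLp 2 (θ z (outputOp W k), y - k) := by
    have : (WithLp.toLp 2 ((0 : G), z • y - T k)) = WithLp.toLp 2 (outputOp W k, z • y)
        - WithLp.toLp 2 (outputOp W k, T k) := by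
      rw [← WithLp.toLp_sub, Prod.mk_sub_mk, sub_self]
    rw [this, map_sub, hy, hk, ← WithLp.toLp_sub, Prod.mk_sub_mk, sub_zero]
  rw [apply_inr, ← hTU] at hsub
  have h1 : outputOp U (z • y - T k) = θ z (outputOp W k) :=
    congrArg (fun p : WithLp 2 (G' × H) => p.fst) hsub
  have h2 : adjoint T (z • y - T k) = y - k :=
    congrArg (fun p : WithLp 2 (G' × H) => p.snd) hsub
  have hy2 : (1 - z • adjoint T) y = defectOp T (defectOp T k) := by
    rw [defectOp_defectOp hT]
    rw [map_sub, map_smul] at h2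
    change y - z • adjoint T y = _
    rw [sub_eq_iff_eq_add] at h2 ⊢
    rw [h2]; abel
  have hunit : IsUnit (1 - z • adjoint T) := by
    refine isUnit_one_sub_of_norm_lt_one ?_
    rw [norm_smul]
    have hz1 : ‖z‖ < 1 := by simpa using hz
    have := norm_adjoint_le hT
    nlinarith [norm_nonneg z, norm_nonneg (adjoint T)]
  have hy3 : Ring.inverse (1 - z • adjoint T) (defectOp T (defectOp T k)) = y := by
    rw [← hy2]
    exact congrArg (fun A : H →L[ℂ] H => A y) (Ring.inverse_mul_cancel _ hunit)
  rw [← h1, ← he']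
  congr 1
  apply Subtype.ext
  change -T (defectOp T k) + z • defectOp (adjoint T) (Ring.inverse (1 - z • adjoint T)
    (defectOp T (defectOp T k))) = defectOp (adjoint T) (z • y - T k)
  rw [hy3, apply_defectOp hT, map_sub, map_smul]
  abel

end IsUnitaryPair

end Colligation

/-! ### Unitarity of the rotations and of the block CMV matrices. -/

namespace ChoiceSequence

variable {M N : Type*}
  [NormedAddCommGroup M] [InnerProductSpace ℂ M]
  [NormedAddCommGroup N] [InnerProductSpace ℂ N]

theorem J_apply (c : ChoiceSequence M N) (n : ℕ) (x : c.E n) (y : c.F (n + 1)) :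
    c.J n (WithLp.toLp 2 (x, y)) =
      WithLp.toLp 2 (c.Γ n x + c.Dstar n y, c.D n x - c.Γstar n y) := rfl

/-- The inclusion of `𝔇_{Γₙ}` in the domain of `Γₙ`. -/
def inclE (c : ChoiceSequence M N) (n : ℕ) : c.E (n + 1) →L[ℂ] c.E n := c.adj.inclF n

theorem inclE_D (c : ChoiceSequence M N) (n : ℕ) (x : c.E n) :
    c.inclE n (c.D n x) = defectOp (c.Γ n) x := rfl

theorem inclE_Γstar (c : ChoiceSequence M N) (n : ℕ) (y : c.F (n + 1)) :
    c.inclE n (c.Γstar n y) = adjoint (c.Γ n) (c.inclF n y) := rfl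

theorem inner_J (c : ChoiceSequence M N) (n : ℕ) (p : WithLp 2 (c.E n × c.F (n + 1)))
    (q : WithLp 2 (c.F n × c.E (n + 1))) :
    ⟪c.J n p, q⟫_ℂ = ⟪p, (c.adj.J n : WithLp 2 (c.F n × c.E (n + 1)) →L[ℂ]
      WithLp 2 (c.E n × c.F (n + 1))) q⟫_ℂ := by
  obtain ⟨x, y⟩ := p
  obtain ⟨a, b⟩ := q
  let u : c.E n := c.adj.Dstar n b
  let v : c.F (n + 1) := c.adj.D n a
  let w : c.F (n + 1) := c.adj.Γstar n b
  have h1 : ⟪c.Γ n x, a⟫_ℂ = ⟪x, adjoint (c.Γ n) a⟫_ℂ :=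
    (ContinuousLinearMap.adjoint_inner_right _ _ _).symm
  have h2 : ⟪c.Dstar n y, a⟫_ℂ = ⟪y, v⟫_ℂ :=
    defectOp_isSelfAdjoint (adjoint (c.Γ n)) (c.inclF n y) a
  have h3 : ⟪c.D n x, b⟫_ℂ = ⟪x, u⟫_ℂ := by
    change ⟪defectOp (c.Γ n) x, c.inclE n b⟫_ℂ
      = ⟪x, defectOp (adjoint (adjoint (c.Γ n))) (c.inclE n b)⟫_ℂ
    rw [ContinuousLinearMap.adjoint_adjoint, defectOp_isSelfAdjoint]
  have h4 : ⟪c.Γstar n y, b⟫_ℂ = ⟪y, w⟫_ℂ := by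
    change ⟪adjoint (c.Γ n) (c.inclF n y), c.inclE n b⟫_ℂ
      = ⟪c.inclF n y, adjoint (adjoint (c.Γ n)) (c.inclE n b)⟫_ℂ
    rw [ContinuousLinearMap.adjoint_inner_right]
  change ⟪WithLp.toLp 2 (c.Γ n x + c.Dstar n y, c.D n x - c.Γstar n y), WithLp.toLp 2 (a, b)⟫_ℂ
    = ⟪WithLp.toLp 2 (x, y), WithLp.toLp 2 (adjoint (c.Γ n) a + u, v - w)⟫_ℂ
  rw [WithLp.prod_inner_apply, WithLp.prod_inner_apply]
  simp only [inner_add_left, inner_sub_left, inner_add_right, inner_sub_right, h1, h2, h3, h4]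
  ring

theorem inclF_injective (c : ChoiceSequence M N) (n : ℕ) : Function.Injective (c.inclF n) :=
  fun _ _ h => Subtype.ext (congrArg (c.F n).subtype h)

theorem adj_J_J (c : ChoiceSequence M N) (n : ℕ) (p : WithLp 2 (c.E n × c.F (n + 1))) :
    (c.adj.J n : WithLp 2 (c.F n × c.E (n + 1)) →L[ℂ]
      WithLp 2 (c.E n × c.F (n + 1))) (c.J n p) = p := by
  obtain ⟨x, y⟩ := p
  have hc := c.contractive n
  refine WithLp.ofLp_injective 2 (Prod.ext ?_ (c.inclF_injective n ?_))
  · change adjoint (c.Γ n) (c.Γ n x + defectOp (adjoint (c.Γ n)) (c.inclF n y))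
      + defectOp (adjoint (adjoint (c.Γ n))) (c.inclE n (c.D n x - c.Γstar n y)) = x
    rw [ContinuousLinearMap.adjoint_adjoint, map_sub, inclE_D, inclE_Γstar, map_add, map_sub,
      adjoint_defectOp hc, defectOp_defectOp hc]
    abel
  · change defectOp (adjoint (c.Γ n)) (c.Γ n x + defectOp (adjoint (c.Γ n)) (c.inclF n y))
      - adjoint (adjoint (c.Γ n)) (c.inclE n (c.D n x - c.Γstar n y)) = c.inclF n y
    rw [map_sub (c.inclE n), inclE_D, inclE_Γstar, map_add, map_sub,
      defectOp_defectOp (norm_adjoint_le hc), ContinuousLinearMap.adjoint_adjoint,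
      apply_defectOp hc]
    abel

/-- Taking adjoints of the choice sequence twice preserves the spaces definitionally, but Γₙ** = Γₙ
must be rewritten. This lets the left inverse property of the adjoint sequence serve as the right
inverse property. -/
theorem adj_adj_J (c : ChoiceSequence M N) (n : ℕ) (p : WithLp 2 (c.E n × c.F (n + 1))) :
    (c.adj.adj.J n : WithLp 2 (c.E n × c.F (n + 1)) →L[ℂ]
      WithLp 2 (c.F n × c.E (n + 1))) p = c.J n p := by
  obtain ⟨x, y⟩ := p
  have h : adjoint (adjoint (c.Γ n)) = c.Γ n := ContinuousLinearMap.adjoint_adjoint _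
  refine WithLp.ofLp_injective 2 (Prod.ext ?_ (Subtype.ext ?_))
  · change adjoint (adjoint (c.Γ n)) x
      + defectOp (adjoint (adjoint (adjoint (c.Γ n)))) (c.inclF n y)
      = c.Γ n x + defectOp (adjoint (c.Γ n)) (c.inclF n y)
    rw [h]
  · change (defectOp (adjoint (adjoint (c.Γ n))) x : M)
      - adjoint (adjoint (adjoint (c.Γ n))) (c.inclF n y)
      = defectOp (c.Γ n) x - adjoint (c.Γ n) (c.inclF n y)
    rw [h]

theorem isUnitaryPair_J (c : ChoiceSequence M N) (n : ℕ) :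
    IsUnitaryPair (c.J n) (c.adj.J n : WithLp 2 (c.F n × c.E (n + 1)) →L[ℂ]
      WithLp 2 (c.E n × c.F (n + 1))) where
  left_inv := c.adj_J_J n
  right_inv q := by
    rw [← adj_adj_J]
    exact c.adj.adj_J_J n q
  inner_left := c.inner_J n

theorem isUnitaryPair_V0 (c : ChoiceSequence M N) :
    IsUnitaryPair c.V0 (c.adj.V0 : c.H0t →L[ℂ] c.H0) :=
  IsUnitaryPair.blockDiag _ _ fun n => c.isUnitaryPair_J (2 * n + 1)

theorem isUnitaryPair_L0 (c : ChoiceSequence M N) :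
    IsUnitaryPair c.L0 (c.adj.L0 : WithLp 2 (c.F (2 * 0) × c.H0) →L[ℂ]
      WithLp 2 (c.E (2 * 0) × c.H0t)) := by
  have h := ((IsUnitaryPair.of_linearIsometryEquiv
    (regroup (fun n => c.F (2 * n)) (fun n => c.E (2 * n + 1)))).symm.comp
      (IsUnitaryPair.blockDiag (fun n => c.norm_J_apply_le (2 * n))
        (fun n => c.adj.norm_J_apply_le (2 * n)) fun n => c.isUnitaryPair_J (2 * n))).comp
    (IsUnitaryPair.of_linearIsometryEquiv
      (regroup (fun n => c.E (2 * n)) (fun n => c.F (2 * n + 1))))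
  exact h

/-- Inversion reverses the order of the factors L₀ and I ⊕ V₀, so the inverse of U₀ is the tilde
matrix of the adjoint sequence. -/
theorem isUnitaryPair_U0 (c : ChoiceSequence M N) :
    IsUnitaryPair c.U0 (c.adj.U0t : WithLp 2 (c.F (2 * 0) × c.H0) →L[ℂ]
      WithLp 2 (c.E (2 * 0) × c.H0)) :=
  c.isUnitaryPair_L0.comp c.isUnitaryPair_V0.idSum

theorem isUnitaryPair_U0t (c : ChoiceSequence M N) :
    IsUnitaryPair c.U0t (c.adj.U0 : WithLp 2 (c.F (2 * 0) × c.H0t) →L[ℂ]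
      WithLp 2 (c.E (2 * 0) × c.H0t)) :=
  c.isUnitaryPair_V0.idSum.comp c.isUnitaryPair_L0

end ChoiceSequence

/-! ### Complete non-unitarity of the truncated CMV matrix. -/

namespace ChoiceSequence

variable {M N : Type*}
  [NormedAddCommGroup M] [InnerProductSpace ℂ M]
  [NormedAddCommGroup N] [InnerProductSpace ℂ N]

/-- This reads L₀ row by row through the regrouping: J₀ sees the external vector and the first entry
of pair 0, and J₂ₙ₊₂ sees the second entry of pair n and the first entry of pair n + 1. -/
theorem L0_apply_eq (c : ChoiceSequence M N) {p : WithLp 2 (c.E (2 * 0) × c.H0t)}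
    {q : WithLp 2 (c.F (2 * 0) × c.H0)}
    (h0 : c.J (2 * 0) (WithLp.toLp 2 (p.fst, (p.snd 0).fst))
      = WithLp.toLp 2 (q.fst, (q.snd 0).fst))
    (h : ∀ n, c.J (2 * (n + 1)) (WithLp.toLp 2 ((p.snd n).snd, (p.snd (n + 1)).fst))
      = WithLp.toLp 2 ((q.snd n).snd, (q.snd (n + 1)).fst)) : c.L0 p = q := by
  have key : blockDiag (fun n => c.J (2 * n)) 4 (fun n => c.norm_J_apply_le (2 * n))
      (regroup (fun n => c.E (2 * n)) (fun n => c.F (2 * n + 1)) p)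
      = regroup (fun n => c.F (2 * n)) (fun n => c.E (2 * n + 1)) q := by
    refine lp.ext (funext fun n => ?_)
    cases n with
    | zero => exact h0
    | succ n => exact h n
  change (regroup (fun n => c.F (2 * n)) (fun n => c.E (2 * n + 1))).symm _ = q
  rw [LinearIsometryEquiv.symm_apply_eq]
  exact key

theorem J_of_L0_apply_eq (c : ChoiceSequence M N) {p : WithLp 2 (c.E (2 * 0) × c.H0t)}
    {q : WithLp 2 (c.F (2 * 0) × c.H0)} (h : c.L0 p = q) :
    c.J (2 * 0) (WithLp.toLp 2 (p.fst, (p.snd 0).fst)) = WithLp.toLp 2 (q.fst, (q.snd 0).fst) ∧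
    ∀ n, c.J (2 * (n + 1)) (WithLp.toLp 2 ((p.snd n).snd, (p.snd (n + 1)).fst))
      = WithLp.toLp 2 ((q.snd n).snd, (q.snd (n + 1)).fst) := by
  have key : blockDiag (fun n => c.J (2 * n)) 4 (fun n => c.norm_J_apply_le (2 * n))
      (regroup (fun n => c.E (2 * n)) (fun n => c.F (2 * n + 1)) p)
      = regroup (fun n => c.F (2 * n)) (fun n => c.E (2 * n + 1)) q := by
    rw [← LinearIsometryEquiv.symm_apply_eq]
    exact h
  exact ⟨congrArg (fun f : PairSum (fun n => c.F (2 * n)) (fun n => c.E (2 * n + 1)) => f 0) key,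
    fun n => congrArg
      (fun f : PairSum (fun n => c.F (2 * n)) (fun n => c.E (2 * n + 1)) => f (n + 1)) key⟩

theorem Dstar_eq_zero (c : ChoiceSequence M N) (n : ℕ) {y : c.F (n + 1)} (h : c.Dstar n y = 0) :
    y = 0 :=
  c.inclF_injective n ((eq_zero_of_mem_of_defectOp_eq_zero
    (c.mem_defectSpace_of_mem n (c.inclF n y) y.2) h).trans (map_zero _).symm)

theorem eq_zero_of_J_inr (c : ChoiceSequence M N) (n : ℕ) {y : c.F (n + 1)}
    (h : (c.J n (WithLp.toLp 2 (0, y))).fst = 0) : y = 0 := by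
  refine c.Dstar_eq_zero n ?_
  rw [J_apply] at h
  simpa using h

/-- The propagation step: with vanishing first input and first output only D_{Γ*}y = 0 remains, and
D_{Γ*} is injective on its defect space. -/
theorem eq_zero_of_J_apply_eq (c : ChoiceSequence M N) (n : ℕ) {x : c.E n} {y : c.F (n + 1)}
    {a : c.F n} {b : c.E (n + 1)} (h : c.J n (WithLp.toLp 2 (x, y)) = WithLp.toLp 2 (a, b))
    (hx : x = 0) (ha : a = 0) : y = 0 ∧ b = 0 := by
  subst hx ha
  have hy : y = 0 := c.eq_zero_of_J_inr n (congrArg WithLp.fst h)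
  refine ⟨hy, ?_⟩
  have h2 : (WithLp.toLp 2 ((0 : c.E n), (0 : c.F (n + 1)))) = 0 := rfl
  rw [hy, h2, map_zero] at h
  exact (congrArg WithLp.snd h).symm

/-- The truncated block operator CMV matrix is completely non-unitary. -/
theorem isCompletelyNonUnitary_T0 (c : ChoiceSequence M N) : IsCompletelyNonUnitary c.T0 := by
  refine ⟨c.isUnitaryPair_U0.norm_truncate_le, fun K _ hT hTs hU => ?_⟩
  -- T₀ preserves the norm on K and U₀ is isometric, so the output component of U₀(0, h) vanishes.
  have hL : ∀ h ∈ K, c.L0 (WithLp.toLp 2 (0, c.V0 h)) = WithLp.toLp 2 (0, c.T0 h) := by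
    intro h hh
    have h1 := c.isUnitaryPair_U0.norm_sq_inr h
    have h2 : ‖c.T0 h‖ ^ 2 = ‖h‖ ^ 2 := by
      have : ⟪c.T0 h, c.T0 h⟫_ℂ = ⟪h, h⟫_ℂ := by
        rw [← ContinuousLinearMap.adjoint_inner_right, (hU h hh).1]
      rw [inner_self_eq_norm_sq_to_K, inner_self_eq_norm_sq_to_K] at this
      exact_mod_cast this
    have h3 : outputOp c.U0 h = 0 := by
      have h4 : ‖outputOp c.U0 h‖ ^ 2 = 0 := by
        change _ + ‖c.T0 h‖ ^ 2 = _ at h1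
        linarith
      simpa using h4
    have h5 := IsUnitaryPair.apply_inr c.U0 h
    rw [h3] at h5
    exact h5
  have hLs : ∀ h ∈ K, c.L0 (WithLp.toLp 2 (0, c.V0 (adjoint c.T0 h))) = WithLp.toLp 2 (0, h) := by
    intro h hh
    rw [hL _ (hTs h hh), (hU h hh).2]
  have hJ := fun h hh => c.J_of_L0_apply_eq (hL h hh)
  have hJs := fun h hh => c.J_of_L0_apply_eq (hLs h hh)
  have snd_zero : ∀ n, (∀ h ∈ K, (h n).fst = 0) → (∀ h ∈ K, (c.V0 h n).fst = 0) →
      ∀ h ∈ K, h n = 0 := by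
    intro n h1 h2 h hh
    have h3 : (c.J (2 * n + 1) (h n)).fst = 0 := h2 h hh
    have h4 : h n = WithLp.toLp 2 (0, (h n).snd) := WithLp.ofLp_injective 2 (Prod.ext (h1 h hh) rfl)
    rw [h4] at h3
    rw [h4, c.eq_zero_of_J_inr (2 * n + 1) h3]
    rfl
  -- The relation for h shows that the first entry of (V₀ h)ₙ vanishes; the relation for T₀*h,
  -- available since K is reducing, shows that the first entry of hₙ vanishes. Together, through
  -- J₂ₙ₊₁, they give hₙ = 0.
  have main : ∀ n, ∀ h ∈ K, h n = 0 := by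
    intro n
    induction n with
    | zero =>
      exact snd_zero 0 (fun h hh => (c.eq_zero_of_J_apply_eq (2 * 0) (hJs h hh).1 rfl rfl).2)
        fun h hh => (c.eq_zero_of_J_apply_eq (2 * 0) (hJ h hh).1 rfl rfl).1
    | succ n ih =>
      have hV : ∀ h ∈ K, (c.V0 h n).snd = 0 := by
        intro h hh
        change (c.J (2 * n + 1) (h n)).snd = 0
        rw [ih h hh, map_zero]
        rfl
      have hh2 : ∀ h ∈ K, (h n).snd = 0 := fun h hh => by rw [ih h hh]; rfl
      exact snd_zero (n + 1)
        (fun h hh => (c.eq_zero_of_J_apply_eq (2 * (n + 1)) ((hJs h hh).2 n)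
          (hV _ (hTs h hh)) (hh2 h hh)).2)
        fun h hh => (c.eq_zero_of_J_apply_eq (2 * (n + 1)) ((hJ h hh).2 n)
          (hV h hh) (hh2 _ (hT h hh))).1
  rw [Submodule.eq_bot_iff]
  exact fun h hh => lp.ext (funext fun n => main n h hh)

end ChoiceSequence

/-! ### The transfer functions of the two block CMV matrices. -/

namespace ChoiceSequence

variable {M N : Type*}
  [NormedAddCommGroup M] [InnerProductSpace ℂ M]
  [NormedAddCommGroup N] [InnerProductSpace ℂ N]

/-- The inputs `x n` and outputs `y n` of the elementary rotations at the point `z`, for the Schur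
iterates `θ`. -/
theorem exists_states (c : ChoiceSequence M N) {θ : ∀ n, ℂ → c.E n →L[ℂ] c.F n}
    (hθ : ∀ n, IsSchurClass (θ n))
    (hm : ∀ n, ∀ z ∈ Metric.ball (0 : ℂ) 1,
      θ n z = c.Γ n + (c.Dstar n).comp ((z • θ (n + 1) z).comp
        ((Ring.inverse (1 + (c.Γstar n).comp (z • θ (n + 1) z))).comp (c.D n))))
    {z : ℂ} (hz : z ∈ Metric.ball (0 : ℂ) 1) (x₀ : c.E 0) :
    ∃ (x : ∀ n, c.E n) (y : ∀ n, c.F n), x 0 = x₀ ∧ y 0 = θ 0 z x₀ ∧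
      (∀ n, c.J n (WithLp.toLp 2 (x n, z • y (n + 1))) = WithLp.toLp 2 (y n, x (n + 1))) ∧
      ∃ C, ∀ n, ‖x n‖ ^ 2 ≤ C ∧ ‖y n‖ ^ 2 ≤ C := by
  have hz1 : ‖z‖ < 1 := by simpa using hz
  choose d hd1 hd2 using fun n => (c.moebius_iff n (θ n z) (θ (n + 1) z)
    ((hθ (n + 1)).contractive z hz) hz).1 (hm n z hz)
  -- The next input is the solution d of d + zΓₙ*Θₙ₊₁(z)d = D_{Γₙ} xₙ supplied by the Möbius
  -- relation.
  let x : ∀ n, c.E n := fun n => Nat.rec (motive := fun n => c.E n) x₀ (fun n x => d n x) n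
  have hxs : ∀ n, x (n + 1) = d n (x n) := fun n => rfl
  let y : ∀ n, c.F n := fun n => θ n z (x n)
  have hJ : ∀ n, c.J n (WithLp.toLp 2 (x n, z • y (n + 1))) = WithLp.toLp 2 (y n, x (n + 1)) := by
    intro n
    rw [J_apply]
    refine WithLp.ofLp_injective 2 (Prod.ext ?_ ?_)
    · exact (hd2 n (x n)).symm
    · exact sub_eq_iff_eq_add.2 (hd1 n (x n)).symm
  have hyx : ∀ n, ‖y n‖ ^ 2 ≤ ‖x n‖ ^ 2 := fun n => by
    refine pow_le_pow_left₀ (norm_nonneg _) ?_ 2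
    simpa using (θ n z).le_of_opNorm_le ((hθ n).contractive z hz) (x n)
  set q := ‖z‖ ^ 2 with hq
  have hq0 : 0 ≤ q := sq_nonneg _
  have hq1 : q < 1 := by rw [hq]; nlinarith [norm_nonneg z]
  have hen : ∀ n, ‖x n‖ ^ 2 + q * ‖y (n + 1)‖ ^ 2 = ‖y n‖ ^ 2 + ‖x (n + 1)‖ ^ 2 := by
    intro n
    have h1 := (c.isUnitaryPair_J n).norm_map (WithLp.toLp 2 (x n, z • y (n + 1)))
    rw [hJ n] at h1
    have h2 := WithLp.prod_norm_sq_eq_of_L2 (WithLp.toLp 2 (x n, z • y (n + 1)))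
    have h3 := WithLp.prod_norm_sq_eq_of_L2 (WithLp.toLp 2 (y n, x (n + 1)))
    have h4 : ‖z • y (n + 1)‖ ^ 2 = q * ‖y (n + 1)‖ ^ 2 := by rw [norm_smul, mul_pow]
    rw [← h4]
    rw [h1] at h3
    exact h2.symm.trans h3
  -- By the energy balance of Jₙ, ‖xₙ‖² - q‖yₙ‖² does not increase with n. Since ‖yₙ‖ ≤ ‖xₙ‖, it is
  -- at least (1 - q)‖xₙ‖², whence the uniform bound.
  have hdec : ∀ n, ‖x n‖ ^ 2 - q * ‖y n‖ ^ 2 ≤ ‖x₀‖ ^ 2 := by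
    intro n
    induction n with
    | zero =>
      have : 0 ≤ q * ‖y 0‖ ^ 2 := by positivity
      have hx0 : ‖x 0‖ ^ 2 = ‖x₀‖ ^ 2 := rfl
      linarith
    | succ n ih =>
      have h1 := hen n
      have h2 : q * ‖y n‖ ^ 2 ≤ ‖y n‖ ^ 2 := mul_le_of_le_one_left (sq_nonneg _) hq1.le
      linarith
  have hbound : ∀ n, ‖x n‖ ^ 2 ≤ ‖x₀‖ ^ 2 / (1 - q) := by
    intro n
    rw [le_div_iff₀ (by linarith)]
    have h1 := hdec n
    have h2 := mul_le_mul_of_nonneg_left (hyx n) hq0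
    linarith
  exact ⟨x, y, rfl, rfl, hJ, ‖x₀‖ ^ 2 / (1 - q), fun n => ⟨hbound n, (hyx n).trans (hbound n)⟩⟩

theorem memℓp_of_geometric {X Y : ℕ → Type*} [∀ n, NormedAddCommGroup (X n)]
    [∀ n, NormedSpace ℂ (X n)] [∀ n, NormedAddCommGroup (Y n)] [∀ n, NormedSpace ℂ (Y n)]
    {z : ℂ} (hz : z ∈ Metric.ball (0 : ℂ) 1) (u : ∀ n, X n) (v : ∀ n, Y n) {C : ℝ}
    (hu : ∀ n, ‖u n‖ ^ 2 ≤ C) (hv : ∀ n, ‖v n‖ ^ 2 ≤ C) :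
    Memℓp (fun n => WithLp.toLp 2 (z ^ n • u n, z ^ n • v n)) 2 := by
  have hz1 : ‖z‖ < 1 := by simpa using hz
  have hs : Summable fun n : ℕ => (‖z‖ ^ 2) ^ n * C :=
    (summable_geometric_of_lt_one (sq_nonneg _) (by nlinarith [norm_nonneg z])).mul_right C
  refine memℓp_of_components (hs.of_nonneg_of_le (fun _ => sq_nonneg _) fun n => ?_)
    (hs.of_nonneg_of_le (fun _ => sq_nonneg _) fun n => ?_)
  · change ‖z ^ n • u n‖ ^ 2 ≤ _
    rw [norm_smul, mul_pow, norm_pow, pow_right_comm]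
    exact mul_le_mul_of_nonneg_left (hu n) (by positivity)
  · change ‖z ^ n • v n‖ ^ 2 ≤ _
    rw [norm_smul, mul_pow, norm_pow, pow_right_comm]
    exact mul_le_mul_of_nonneg_left (hv n) (by positivity)

theorem J_pow_smul (c : ChoiceSequence M N) (n : ℕ) {z : ℂ} {x : c.E n} {y : c.F (n + 1)}
    {a : c.F n} {b : c.E (n + 1)} (h : c.J n (WithLp.toLp 2 (x, z • y)) = WithLp.toLp 2 (a, b))
    (k : ℕ) : c.J n (WithLp.toLp 2 (z ^ k • x, z ^ (k + 1) • y))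
      = WithLp.toLp 2 (z ^ k • a, z ^ k • b) := by
  have h1 : WithLp.toLp 2 (z ^ k • x, z ^ (k + 1) • y) = z ^ k • WithLp.toLp 2 (x, z • y) := by
    rw [← WithLp.toLp_smul, Prod.smul_mk, smul_smul, pow_succ]
  rw [h1, map_smul, h, ← WithLp.toLp_smul, Prod.smul_mk]

/-- `Θ` is the transfer function of the block operator CMV matrix `U₀`. -/
theorem exists_U0_apply_eq (c : ChoiceSequence M N) {θ : ∀ n, ℂ → c.E n →L[ℂ] c.F n}
    (hθ : ∀ n, IsSchurClass (θ n))
    (hm : ∀ n, ∀ z ∈ Metric.ball (0 : ℂ) 1,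
      θ n z = c.Γ n + (c.Dstar n).comp ((z • θ (n + 1) z).comp
        ((Ring.inverse (1 + (c.Γstar n).comp (z • θ (n + 1) z))).comp (c.D n))))
    (z : ℂ) (hz : z ∈ Metric.ball (0 : ℂ) 1) (x₀ : c.E (2 * 0)) :
    ∃ h : c.H0, c.U0 (WithLp.toLp 2 (x₀, z • h)) = WithLp.toLp 2 (θ (2 * 0) z x₀, h) := by
  obtain ⟨x, y, rfl, hy, hJ, C, hC⟩ := c.exists_states hθ hm hz x₀
  have hz1 : ‖z‖ < 1 := by simpa using hz
  have hzy : ∀ n, ‖z • y n‖ ^ 2 ≤ C := fun n => by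
    rw [norm_smul, mul_pow]
    exact (mul_le_of_le_one_left (sq_nonneg _) (pow_le_one₀ (norm_nonneg _) hz1.le)).trans (hC n).2
  -- One application of U₀ passes two rotations, so the weight is zⁿ on pair n, and the extra z on
  -- y₂ₙ₊₂ is the one that J₂ₙ₊₁ expects at its second input.
  let h : c.H0 := ⟨fun n => WithLp.toLp 2 (z ^ n • x (2 * n + 1), z ^ n • z • y (2 * (n + 1))),
    memℓp_of_geometric hz (fun n => x (2 * n + 1)) (fun n => z • y (2 * (n + 1)))
      (fun n => (hC _).1) (fun n => hzy _)⟩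
  refine ⟨h, ?_⟩
  have hV : ∀ n, c.V0 (z • h) n
      = WithLp.toLp 2 (z ^ (n + 1) • y (2 * n + 1), z ^ (n + 1) • x (2 * (n + 1))) := by
    intro n
    have h1 := c.J_pow_smul (2 * n + 1) (hJ (2 * n + 1)) (n + 1)
    refine Eq.trans ?_ h1
    change c.J (2 * n + 1) (WithLp.toLp 2
      (z • z ^ n • x (2 * n + 1), z • z ^ n • z • y (2 * (n + 1)))) = _
    simp only [smul_smul, ← pow_succ, ← pow_succ']
    rfl
  have hV1 : ∀ n, (c.V0 (z • h) n).fst = z ^ (n + 1) • y (2 * n + 1) := fun n => by rw [hV]; rfl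
  have hV2 : ∀ n, (c.V0 (z • h) n).snd = z ^ (n + 1) • x (2 * (n + 1)) := fun n => by rw [hV]; rfl
  refine c.L0_apply_eq ?_ fun n => ?_
  · change c.J (2 * 0) (WithLp.toLp 2 (x 0, (c.V0 (z • h) 0).fst))
      = WithLp.toLp 2 (θ 0 z (x 0), z ^ 0 • x (2 * 0 + 1))
    rw [hV1, pow_zero, one_smul, zero_add, pow_one, ← hy]
    exact hJ 0
  · change c.J (2 * (n + 1)) (WithLp.toLp 2
        ((c.V0 (z • h) n).snd, (c.V0 (z • h) (n + 1)).fst))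
      = WithLp.toLp 2 (z ^ n • z • y (2 * (n + 1)), z ^ (n + 1) • x (2 * (n + 1) + 1))
    rw [hV1, hV2, c.J_pow_smul (2 * (n + 1)) (hJ (2 * (n + 1))) (n + 1), smul_smul, pow_succ]

/-- `Θ` is the transfer function of the block operator CMV matrix `Ũ₀`. -/
theorem exists_U0t_apply_eq (c : ChoiceSequence M N) {θ : ∀ n, ℂ → c.E n →L[ℂ] c.F n}
    (hθ : ∀ n, IsSchurClass (θ n))
    (hm : ∀ n, ∀ z ∈ Metric.ball (0 : ℂ) 1,
      θ n z = c.Γ n + (c.Dstar n).comp ((z • θ (n + 1) z).comp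
        ((Ring.inverse (1 + (c.Γstar n).comp (z • θ (n + 1) z))).comp (c.D n))))
    (z : ℂ) (hz : z ∈ Metric.ball (0 : ℂ) 1) (x₀ : c.E (2 * 0)) :
    ∃ h : c.H0t, c.U0t (WithLp.toLp 2 (x₀, z • h)) = WithLp.toLp 2 (θ (2 * 0) z x₀, h) := by
  obtain ⟨x, y, rfl, hy, hJ, C, hC⟩ := c.exists_states hθ hm hz x₀
  have hz1 : ‖z‖ < 1 := by simpa using hz
  have hzy : ∀ n, ‖z • y n‖ ^ 2 ≤ C := fun n => by
    rw [norm_smul, mul_pow]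
    exact (mul_le_of_le_one_left (sq_nonneg _) (pow_le_one₀ (norm_nonneg _) hz1.le)).trans (hC n).2
  let h : c.H0t := ⟨fun n => WithLp.toLp 2 (z ^ n • y (2 * n + 1), z ^ n • x (2 * (n + 1))),
    memℓp_of_geometric hz (fun n => y (2 * n + 1)) (fun n => x (2 * (n + 1)))
      (fun n => (hC _).2) (fun n => (hC _).1)⟩
  -- The intermediate vector between the two factors: L₀ sends (x₀, zh) to (Θ(z)x₀, g), and V₀ sends
  -- g to h.
  let g : c.H0 := ⟨fun n => WithLp.toLp 2 (z ^ n • x (2 * n + 1), z ^ n • z • y (2 * (n + 1))),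
    memℓp_of_geometric hz (fun n => x (2 * n + 1)) (fun n => z • y (2 * (n + 1)))
      (fun n => (hC _).1) (fun n => hzy _)⟩
  refine ⟨h, ?_⟩
  have hL : c.L0 (WithLp.toLp 2 (x 0, z • h)) = WithLp.toLp 2 (θ 0 z (x 0), g) := by
    refine c.L0_apply_eq ?_ fun n => ?_
    · change c.J (2 * 0) (WithLp.toLp 2 (x 0, z • z ^ 0 • y (2 * 0 + 1)))
        = WithLp.toLp 2 (θ 0 z (x 0), z ^ 0 • x (2 * 0 + 1))
      rw [pow_zero, one_smul, one_smul, ← hy]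
      exact hJ 0
    · change c.J (2 * (n + 1)) (WithLp.toLp 2
          (z • z ^ n • x (2 * (n + 1)), z • z ^ (n + 1) • y (2 * (n + 1) + 1)))
        = WithLp.toLp 2 (z ^ n • z • y (2 * (n + 1)), z ^ (n + 1) • x (2 * (n + 1) + 1))
      have h1 := c.J_pow_smul (2 * (n + 1)) (hJ (2 * (n + 1))) (n + 1)
      simp only [smul_smul, ← pow_succ, ← pow_succ']
      exact h1
  have hV : c.V0 g = h := by
    refine lp.ext (funext fun n => ?_)
    have h1 := c.J_pow_smul (2 * n + 1) (hJ (2 * n + 1)) n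
    refine Eq.trans ?_ h1
    change c.J (2 * n + 1) (WithLp.toLp 2
      (z ^ n • x (2 * n + 1), z ^ n • z • y (2 * (n + 1)))) = _
    rw [smul_smul, ← pow_succ]
    rfl
  change c.M0t (c.L0 _) = _
  rw [hL, ← hV]
  rfl

end ChoiceSequence

end BlockCMV

end

/-! ### Assembly of the theorem. -/

theorem theorem7p2
    {M N : Type*}
    [NormedAddCommGroup M] [InnerProductSpace ℂ M] [CompleteSpace M]
    [NormedAddCommGroup N] [InnerProductSpace ℂ N] [CompleteSpace N]
    (Θ : ℂ → M →L[ℂ] N)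
    (hΘ : BlockCMV.IsSchurClass Θ) (hpure : BlockCMV.IsPurelyContractive Θ) :
    (∃ c : BlockCMV.ChoiceSequence M N, c.IsSchurParametersOf Θ) ∧
    ∀ c : BlockCMV.ChoiceSequence M N, c.IsSchurParametersOf Θ →
      (BlockCMV.IsCompletelyNonUnitary c.adj.T0 ∧
        ∃ hT : ‖c.adj.T0‖ ≤ 1, BlockCMV.Coincide (BlockCMV.charFun c.adj.T0 hT) Θ) ∧
      (BlockCMV.IsCompletelyNonUnitary c.adj.T0t ∧
        ∃ hT : ‖c.adj.T0t‖ ≤ 1, BlockCMV.Coincide (BlockCMV.charFun c.adj.T0t hT) Θ) := by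
  refine ⟨hΘ.exists_isSchurParametersOf, ?_⟩
  rintro c ⟨θ, hθ, hθ0, hΓ, hm⟩
  have hpure0 : ∀ x, ‖θ (2 * 0) 0 x‖ = ‖x‖ → x = 0 := by
    intro x hx
    have h0 := BlockCMV.norm_defectOp_sq (hΘ.contractive 0 (by simp)) (x : M)
    have h1 : ‖Θ 0 x‖ = ‖(x : M)‖ := by
      rw [← hθ0 0 (by simp) x]
      exact hx
    rw [h1, sub_self] at h0
    have h2 : (x : M) ∈ (BlockCMV.defectOp (Θ 0)).ker := by
      rw [LinearMap.mem_ker]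
      simpa using h0
    rw [hpure] at h2
    exact Subtype.ext (by simpa using h2)
  -- The spaces `E 0` and `F 0` are the full subspaces of M and N; the canonical unitaries are
  -- absorbed into the coincidence.
  have hcoin : ∀ {H K : Type _} [NormedAddCommGroup H] [InnerProductSpace ℂ H] [CompleteSpace H]
      [NormedAddCommGroup K] [InnerProductSpace ℂ K] [CompleteSpace K] (φ : ℂ → H →L[ℂ] K),
      BlockCMV.Coincide φ (θ (2 * 0)) → BlockCMV.Coincide φ Θ := by
    intro H K _ _ _ _ _ _ φ
    rintro ⟨V, U, h⟩
    refine ⟨V.trans (LinearIsometryEquiv.ofTop N _ c.F_zero),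
      (LinearIsometryEquiv.ofTop M _ c.E_zero).symm.trans U, fun z hz x => ?_⟩
    have h1 := h z hz ((LinearIsometryEquiv.ofTop M _ c.E_zero).symm x)
    have h2 := hθ0 z hz ((LinearIsometryEquiv.ofTop M _ c.E_zero).symm x)
    exact (congrArg Subtype.val h1).trans h2
  have hU := c.isUnitaryPair_U0
  have hUt := c.isUnitaryPair_U0t
  have hT : ‖c.adj.T0‖ ≤ 1 := hUt.symm.norm_truncate_le
  have hTt : ‖c.adj.T0t‖ ≤ 1 := hU.symm.norm_truncate_le
  -- The operators of the adjoint sequence are the state operators of the inverses of Ũ₀ and U₀,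
  -- which explains the crossed pairing with the transfer identities. For T̃₀, complete
  -- non-unitarity comes from its being the adjoint of T₀ of {Γₙ}.
  refine ⟨⟨c.adj.isCompletelyNonUnitary_T0, hT, hcoin _ ?_⟩, ⟨?_, hTt, hcoin _ ?_⟩⟩
  · exact hUt.coincide_charFun _ (c.exists_U0t_apply_eq hθ hm) hpure0 hT
  · have h : ContinuousLinearMap.adjoint c.T0 = c.adj.T0t := hU.adjoint_truncate
    exact h ▸ c.isCompletelyNonUnitary_T0.adjoint
  · exact hU.coincide_charFun _ (c.exists_U0_apply_eq hθ hm) hpure0 hTt
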